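/- **Setting.** Let $\mathcal M=(\mathcal S,\mathcal A,r,\gamma,P)$ be a finite discounted Markov decision process with non-empty state and action sets, rewards $r:\mathcal S\times\mathcal A\to[0,1]$, discount factor $\gamma\in(0,1)$ and transition kernel $P$. For a stationary randomized policy $\pi$ let $V^\pi(s)=\mathbb E_\pi[\sum_{t\ge0}\gamma^t r(s_t,a_t)\mid s_0=s]$, and let $V^\star(s)=\max_\pi V^\pi(s)$. Let $\phi$ be a mirror map of Legendre type (convex on its domain, strictly convex and differentiable in the interior of the domain, with gradients that blow up at the boundary) whose domain contains the simplex $\Delta(\mathcal A)$ and whose domain has the relative interior of $\Delta(\mathcal A)$ in its interior. Let $D_\phi$ be its Bregman divergence. Fix a lookahead depth $h\ge1$, a target accuracy $\epsilon>0$ and $\delta\in(0,1)$. **Algorithm (inexact $h$-PMD under a generative model).** Start with a policy $\pi_0$ such that $\pi_0(a|s)>0$ for all $s,a$. In each iteration $k=0,\dots,K-1$ draw fresh samples: for each level $j=1,\dots,h$ and each $(s,a)$, draw $M$ independent next states from $P(\cdot|s,a)$; from each state $s$ draw $M_0$ independent rollouts of length $H\ge 1$ of the policy $\pi_k$. Let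 $\hat V_1(s)$ be the average discounted return of the rollouts from $s$, and, for $j=1,\dots,h$, let $\hat Q_j(s,a)=r(s,a)+\frac{\gamma}{M}\sum_{s'}\hat V_j(s')$, the sum being over the $M$ next states drawn at level $j$ for $(s,a)$, and $\hat V_{j+1}(s)=\max_a\hat Q_j(s,a)$; the tree is shared by all root pairs. Then $$\pi_{k+1}(\cdot|s)\in\arg\max_{p\in\Delta(\mathcal A)}\{\eta_k\langle\hat Q_h(s,\cdot),p\rangle-D_\phi(p,\pi_k(\cdot|s))\}\quad\text{for all } s,$$ with any (possibly data-dependent) step size $\eta_k>0$ such that $\eta_k\ge\frac1{c_k}\|\min_{\tilde\pi}D_\phi(\tilde\pi,\pi_k)\|_\infty$, where $c_k=\gamma^{2h(k+1)}$ and the (componentwise) minimum is over the policies $\tilde\pi$ that are greedy with respect to $\hat Q_h$. **Parameters.** For $\delta'>0$ say that $(K,M,M_0,H)$ is *admissible at level $\delta'$* if $$K>T:=\tfrac{1}{h(1-\gamma)}\log\tfrac{4}{\epsilon(1-\gamma)(1-\gamma^h)},\qquad M>\tfrac{144}{(1-\gamma)^6\epsilon^2}\log\tfrac{4h|\mathcal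 A||\mathcal S|\cdot|\mathcal S\times\mathcal A|}{\delta'},$$ $$M_0\ge\tfrac{144\gamma^{2h}}{(1-\gamma)^4(1-\gamma^h)^2\epsilon^2}\log\tfrac{4|\mathcal S|\cdot|\mathcal S\times\mathcal A|}{\delta'},\qquad H\ge1,\quad H>\tfrac1{1-\gamma}\log\tfrac{3\gamma^h}{b(1-\gamma)},\quad b=\tfrac{\epsilon(1-\gamma)(1-\gamma^h)}4 .$$ Write $(\ast_k)$ for the bound $$\|V^\star-V^{\pi_k}\|_\infty\le\gamma^{hk}\Big(\|V^\star-V^{\pi_0}\|_\infty+\frac{1-\gamma^{hk}}{(1-\gamma)(1-\gamma^h)}\Big)+\epsilon .$$ **Theorem (sample complexity of $h$-PMD).** 1. If the parameters are admissible at level $\delta$, then for each $k\le K$ the bound $(\ast_k)$ holds with probability at least $1-\delta$. 2. If the parameters are admissible at level $\delta/K$, then with probability at least $1-\delta$ the bounds $(\ast_k)$ hold for all $k\le K$ simultaneously and $\|V^\star-V^{\pi_K}\|_\infty\le\epsilon$. 3. The algorithm uses $K M_0 H|\mathcal S|+K h M|\mathcal S||\mathcal A|$ samples in total. 4. There are universal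 constants $C>0$ and $p\in\mathbb N$ such that, if $T\ge1$ and $K,M,M_0,H$ are the least integers admissible at level $\delta$ or the least ones at level $\delta/K$, then the total number of samples is at most $$C\Big(\frac{|\mathcal S|}{h\epsilon^2(1-\gamma)^6(1-\gamma^h)^2}+\frac{|\mathcal S||\mathcal A|}{\epsilon^2(1-\gamma)^7}\Big)\Big(1+\log\frac{|\mathcal S||\mathcal A|h(1+1/\epsilon)}{\delta(1-\gamma)}\Big)^p ,$$ that is, $\tilde O\big(\frac{|\mathcal S|}{h\epsilon^2(1-\gamma)^6(1-\gamma^h)^2}+\frac{|\mathcal S||\mathcal A|}{\epsilon^2(1-\gamma)^7}\big)$. -/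

import Mathlib

open Filter Topology MeasureTheory ProbabilityTheory

universe u v w

noncomputable section

namespace HPMD

/-- A finite discounted Markov decision process: transition kernel, rewards in `[0,1]`,
discount factor in `(0,1)`. (An initial state distribution plays no role in sup-norm claims.) -/
structure MDP (S : Type u) (A : Type v) [Fintype S] [Fintype A] where
  /-- `P s a s'` is the probability to move from `s` to `s'` under action `a`. -/
  P : S → A → S → ℝ
  P_mem : ∀ s a, P s a ∈ stdSimplex ℝ S
  r : S → A → ℝ
  r_mem : ∀ s a, r s a ∈ Set.Icc (0 : ℝ) 1
  γ : ℝ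
  γ_pos : 0 < γ
  γ_lt_one : γ < 1

/-- Randomized stationary policies; `π s a` is the probability of action `a` in state `s`. -/
def IsPolicy {S : Type u} {A : Type v} [Fintype A] (π : S → A → ℝ) : Prop :=
  ∀ s, π s ∈ stdSimplex ℝ A

section Trajectories

variable {S : Type u} {A : Type v} [Fintype S] [Fintype A]

/-- A trajectory of length `n` started in `s` is recorded as `τ : Fin n → A × S`: the action taken
at each time and the state reached by it. `visited s τ` lists the states `s_0 = s, s_1, …, s_n`. -/
def visited {n : ℕ} (s : S) (τ : Fin n → A × S) : Fin (n + 1) → S :=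
  Fin.cons s fun t => (τ t).2

/-- Probability of the trajectory `τ` when `a_t ∼ π(·|s_t)` and `s_{t+1} ∼ P(·|s_t,a_t)`. -/
def MDP.trajProb (m : MDP S A) (π : S → A → ℝ) {n : ℕ} (s : S) (τ : Fin n → A × S) : ℝ :=
  ∏ t : Fin n, π (visited s τ t.castSucc) (τ t).1 *
    m.P (visited s τ t.castSucc) (τ t).1 (visited s τ t.succ)

/-- The expectation of `r(s_t, a_t)` when the chain starts in `s` and follows `π`. -/
def MDP.expReward (m : MDP S A) (π : S → A → ℝ) (s : S) (t : ℕ) : ℝ :=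
  ∑ τ : Fin (t + 1) → A × S,
    m.trajProb π s τ * m.r (visited s τ (Fin.last t).castSucc) (τ (Fin.last t)).1

/-- The value function `V^π(s)`, the expected discounted sum of rewards. -/
def MDP.V (m : MDP S A) (π : S → A → ℝ) (s : S) : ℝ :=
  ∑' t : ℕ, m.γ ^ t * m.expReward π s t

/-- The optimal value function `V^⋆(s) = sup_π V^π(s)`. -/
def MDP.Vstar (m : MDP S A) (s : S) : ℝ :=
  ⨆ π : {π : S → A → ℝ // IsPolicy π}, m.V π.1 s

/-- Discounted return of a trajectory. -/
def MDP.ret (m : MDP S A) {n : ℕ} (s : S) (τ : Fin n → A × S) : ℝ :=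
  ∑ t : Fin n, m.γ ^ (t : ℕ) * m.r (visited s τ t.castSucc) (τ t).1

end Trajectories

section Mirror

variable {A : Type v} [Fintype A]

/-- `φ`, with effective domain `dom`, is a mirror map of Legendre type on the simplex: convex on
`dom`, strictly convex and differentiable in the interior, with gradients that blow up at the
boundary; the simplex lies in the domain and its relative interior in the interior. -/
structure IsMirrorMap (φ : (A → ℝ) → ℝ) (dom : Set (A → ℝ)) : Prop where
  simplex_subset : stdSimplex ℝ A ⊆ dom
  relint_subset : ∀ p ∈ stdSimplex ℝ A, (∀ a, 0 < p a) → p ∈ interior dom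
  convexOn : ConvexOn ℝ dom φ
  strictConvexOn : StrictConvexOn ℝ (interior dom) φ
  differentiableAt : ∀ x ∈ interior dom, DifferentiableAt ℝ φ x
  steep : ∀ x ∈ frontier dom, Tendsto (fun y => ‖fderiv ℝ φ y‖) (𝓝[interior dom] x) atTop

/-- The Bregman divergence `D_φ(p, q) = φ(p) - φ(q) - ⟨∇φ(q), p - q⟩`. -/
def bregman (φ : (A → ℝ) → ℝ) (p q : A → ℝ) : ℝ :=
  φ p - φ q - fderiv ℝ φ q (p - q)

variable {S : Type u} [Fintype S]

/-- The policies that maximize `π ↦ M^π Q` (simultaneously in all states), where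
`(M^π Q)(s) = ∑ a, π(a|s) Q(s,a)`. -/
def greedy (Q : S → A → ℝ) : Set (S → A → ℝ) :=
  {π | IsPolicy π ∧ ∀ π' : S → A → ℝ, IsPolicy π' →
    ∀ s, ∑ a, π' s a * Q s a ≤ ∑ a, π s a * Q s a}

/-- The vector `min_{π ∈ greedy Q} D_φ(π, π')`, the minimum being taken componentwise. -/
def minDiv (φ : (A → ℝ) → ℝ) (Q π' : S → A → ℝ) (s : S) : ℝ :=
  sInf ((fun π : S → A → ℝ => bregman φ (π s) (π' s)) '' greedy Q)

end Mirror

section Sampling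

/-- Planning calls to the simulator in one iteration: level `k + 1 ∈ {1, …, h}` of the planning
tree (`k : Fin h`), queried state-action pair, and index of the repetition. The tree is shared by
all root pairs `(s,a)`, so that every state occurs (once) at every level. -/
abbrev TreeCall (S : Type u) (A : Type v) (h M : ℕ) := Fin h × S × A × Fin M

/-- Rollout calls to the simulator in one iteration: starting state, index of the rollout,
and time step. -/
abbrev RolloutCall (S : Type u) (M₀ H : ℕ) := S × Fin M₀ × Fin H

/-- What one iteration observes: a next state for each planning call, and an action drawn from the
current policy together with a next state for each rollout call. -/
abbrev Samples (S : Type u) (A : Type v) (h M M₀ H : ℕ) :=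
  (TreeCall S A h M → S) × (RolloutCall S M₀ H → A × S)

variable {S : Type u} {A : Type v} [Fintype S] [Fintype A] {h M M₀ H : ℕ}

/-- The `j`-th rollout from state `s`. -/
def rollout (x : Samples S A h M M₀ H) (s : S) (j : Fin M₀) : Fin H → A × S :=
  fun t => x.2 (s, j, t)

/-- Probability that one iteration with current policy `π` observes `x`: the planning calls and the
rollouts are mutually independent, planning calls at `(s,a)` are answered by `P(·|s,a)`, and
rollouts follow `π`. -/
def MDP.sampleProb (m : MDP S A) (π : S → A → ℝ) (x : Samples S A h M M₀ H) : ℝ :=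
  (∏ c : TreeCall S A h M, m.P c.2.1 c.2.2.1 (x.1 c)) *
    ∏ s : S, ∏ j : Fin M₀, m.trajProb π s (rollout x s j)

/-- `V̂_1(s)`: the average of the returns of the rollouts from `s`. -/
def MDP.rolloutValue (m : MDP S A) (x : Samples S A h M M₀ H) (s : S) : ℝ :=
  (1 / (M₀ : ℝ)) * ∑ j : Fin M₀, m.ret s (rollout x s j)

/-- The sampled backup `Q̂(s,a) = r(s,a) + (γ/M) ∑_j V(s'_j)`, with the next states that were drawn
from `P(·|s,a)` at level `k + 1`. -/
def MDP.backup (m : MDP S A) (x : Samples S A h M M₀ H) (k : Fin h) (V : S → ℝ) (s : S) (a : A) :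
    ℝ :=
  m.r s a + (m.γ / (M : ℝ)) * ∑ j : Fin M, V (x.1 (k, s, a, j))

/-- `vHat k` is `V̂_{k+1}`: it starts from the rollout values, and
`V̂_{k+2}(s) = max_a Q̂_{k+1}(s,a)`. -/
def MDP.vHat (m : MDP S A) (x : Samples S A h M M₀ H) : (k : ℕ) → k < h → S → ℝ
  | 0, _ => m.rolloutValue x
  | k + 1, hk => fun s =>
      ⨆ a, m.backup x ⟨k, Nat.lt_of_succ_lt hk⟩ (m.vHat x k (Nat.lt_of_succ_lt hk)) s a

/-- The estimate `Q̂_h` of the lookahead action values, at all state-action pairs. -/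
def MDP.qHat (m : MDP S A) (hh : 0 < h) (x : Samples S A h M M₀ H) : S → A → ℝ :=
  m.backup x ⟨h - 1, Nat.sub_lt hh Nat.one_pos⟩ (m.vHat x (h - 1) (Nat.sub_lt hh Nat.one_pos))

/-- Number of simulator calls made in `K` iterations. -/
def totalSamples (S : Type u) (A : Type v) [Fintype S] [Fintype A] (K h M M₀ H : ℕ) : ℕ :=
  Fintype.card (Fin K × (TreeCall S A h M ⊕ RolloutCall S M₀ H))

/-- A run of `K` iterations of inexact `h`-PMD under a generative model, with
`c_k = γ^{2h(k+1)}`. The σ-algebra `ℱ k` is the information available before iteration `k`. -/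
structure IsRun {Ω : Type w} {mΩ : MeasurableSpace Ω} {K : ℕ} (m : MDP S A) (φ : (A → ℝ) → ℝ)
    (hh : 0 < h) (π₀ : S → A → ℝ) (μ : Measure Ω) (ℱ : Filtration ℕ mΩ)
    (X : Fin K → Ω → Samples S A h M M₀ H) (η : Fin K → Ω → ℝ) (π : ℕ → Ω → S → A → ℝ) :
    Prop where
  /-- The iterate `π_k` is determined by the past, … -/
  policy_measurable : ∀ k ≤ K, Measurable[ℱ k] (π k)
  /-- … the samples of iteration `k` belong to the past of iteration `k + 1`, … -/
  sample_measurable : ∀ (k : Fin K) (x : Samples S A h M M₀ H),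
    MeasurableSet[ℱ (k + 1)] (X k ⁻¹' {x})
  /-- … and given the past, their conditional distribution is `sampleProb π_k`. -/
  sample_law : ∀ (k : Fin K) (x : Samples S A h M M₀ H) (E : Set Ω), MeasurableSet[ℱ k] E →
    μ (E ∩ X k ⁻¹' {x}) = ∫⁻ ω in E, ENNReal.ofReal (m.sampleProb (π k ω) x) ∂μ
  init : ∀ᵐ ω ∂μ, π 0 ω = π₀
  stepsize_pos : ∀ᵐ ω ∂μ, ∀ k : Fin K, 0 < η k ω
  stepsize : ∀ᵐ ω ∂μ, ∀ k : Fin K,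
    1 / m.γ ^ (2 * h * (k + 1 : ℕ)) * ‖minDiv φ (m.qHat hh (X k ω)) (π k ω)‖ ≤ η k ω
  policy_mem : ∀ᵐ ω ∂μ, ∀ k : Fin K, IsPolicy (π (k + 1) ω)
  update : ∀ᵐ ω ∂μ, ∀ (k : Fin K) (s : S),
    IsMaxOn (fun p : A → ℝ =>
      η k ω * ∑ a, m.qHat hh (X k ω) s a * p a - bregman φ p (π k ω s))
      (stdSimplex ℝ A) (π (k + 1) ω s)

end Sampling

section Parameters

variable {S : Type u} {A : Type v} [Fintype S] [Fintype A]

/-- The threshold `log(4 / (ε(1-γ)(1-γ^h))) / (h(1-γ))` for the number of iterations. -/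
def MDP.iterBound (m : MDP S A) (h : ℕ) (ε : ℝ) : ℝ :=
  1 / (h * (1 - m.γ)) * Real.log (4 / (ε * (1 - m.γ) * (1 - m.γ ^ h)))

/-- The threshold for the number `M` of next states drawn per node, at confidence level `δ`. -/
def MDP.treeBound (m : MDP S A) (h : ℕ) (ε δ : ℝ) : ℝ :=
  144 / ((1 - m.γ) ^ 6 * ε ^ 2) *
    Real.log (4 * h * Fintype.card A * Fintype.card S * Fintype.card (S × A) / δ)

/-- The number `M₀` of rollouts per state, at confidence level `δ`. -/
def MDP.rolloutBound (m : MDP S A) (h : ℕ) (ε δ : ℝ) : ℝ :=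
  144 * m.γ ^ (2 * h) / ((1 - m.γ) ^ 4 * (1 - m.γ ^ h) ^ 2 * ε ^ 2) *
    Real.log (4 * Fintype.card S * Fintype.card (S × A) / δ)

/-- The threshold `log(3γ^h / (b(1-γ))) / (1-γ)`, `b = ε(1-γ)(1-γ^h)/4`, for the length of the
rollouts. -/
def MDP.lengthBound (m : MDP S A) (h : ℕ) (ε : ℝ) : ℝ :=
  1 / (1 - m.γ) *
    Real.log (3 * m.γ ^ h / (ε * (1 - m.γ) * (1 - m.γ ^ h) / 4 * (1 - m.γ)))

/-- The requirements on the parameters of the algorithm. -/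
structure Admissible (m : MDP S A) (h : ℕ) (ε δ : ℝ) (K M M₀ H : ℕ) : Prop where
  iter : m.iterBound h ε < K
  tree : m.treeBound h ε δ < M
  rollout : m.rolloutBound h ε δ ≤ M₀
  length_pos : 1 ≤ H
  length : m.lengthBound h ε < H

/-- The least natural numbers that meet the requirements. -/
structure LeastAdmissible (m : MDP S A) (h : ℕ) (ε δ : ℝ) (K M M₀ H : ℕ) : Prop where
  iter : IsLeast {n : ℕ | m.iterBound h ε < n} K
  tree : IsLeast {n : ℕ | m.treeBound h ε δ < n} M
  rollout : IsLeast {n : ℕ | m.rolloutBound h ε δ ≤ n} M₀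
  length : IsLeast {n : ℕ | 1 ≤ n ∧ m.lengthBound h ε < n} H

/-- The bound on the suboptimality of the `k`-th iterate. -/
def MDP.subopt (m : MDP S A) (h : ℕ) (ε : ℝ) (π₀ : S → A → ℝ) (k : ℕ) : ℝ :=
  m.γ ^ (h * k) * (‖m.Vstar - m.V π₀‖ +
    (1 - m.γ ^ (h * k)) / ((1 - m.γ) * (1 - m.γ ^ h))) + ε

end Parameters

end HPMD

end

/-! Write T for the Bellman optimality operator. The proof is approximate policy iteration with
lookahead, plus concentration for an average of the estimation errors over iterations.

Deterministic part. The step-size rule makes the mirror step c-greedy for the estimate `qHat`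
(`IsMirrorMap.le_update_add`), hence (2 `estErr` + c)-greedy for the lookahead values built on
T^(h-1) V^π. Since V^π ≤ T V^π, the iterates T^n V^π increase. A policy that is e-greedy for such a
vector loses at most e/(1-γ) against T^h V^π (`MDP.bellOpt_le_V_add`), while T^h V^π is within γ^h
‖V⋆ - V^π‖ of V⋆ from below. The recursion `MDP.norm_Vstar_sub_update_le` follows. Unrolling it
(`unroll_recursion`) turns the c_k into the stated bias and leaves 2/(1-γ) times a geometrically
weighted sum of the errors `estErr`.

Random part. `estErr` splits into tree deviations, rollout deviations and a truncation bias. Given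
the past, each empirical mean averages fresh draws of a bounded function fixed by the other draws,
so Hoeffding's lemma bounds its exponential moment. Maxima over states or pairs cost a cardinality
factor. Convexity of exp then gives a Chernoff bound for the weighted sum over all iterations and
levels (`measure_lt_sum_mul_le`). This needs no independence between the terms and no union bound
over iterations, so level δ suffices for a single k. Each error source contributes at most
ε(1-γ)/12, in total ε/2 after the factor 2/(1-γ). The other ε/2 absorbs the bias at k = K. A union
bound over k gives the simultaneous claim.

Complexity. Every logarithm in the thresholds is at most a constant times one quantity Y, and the
condition T ≥ 1 lets each rounding up be absorbed. -/

namespace HPMD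

/-! ### Bellman operators: monotonicity and contraction. -/

section BellmanOperators

variable {S : Type u} {A : Type v} [Fintype S] [Fintype A]

/-- Action values of a one-step lookahead from the value vector `v`. -/
noncomputable def MDP.q (m : MDP S A) (v : S → ℝ) (s : S) (a : A) : ℝ :=
  m.r s a + m.γ * ∑ s', m.P s a s' * v s'

/-- The Bellman operator of a policy. -/
noncomputable def MDP.bellPol (m : MDP S A) (π : S → A → ℝ) (v : S → ℝ) (s : S) : ℝ :=
  ∑ a, π s a * m.q v s a

/-- The Bellman optimality operator. -/
noncomputable def MDP.bellOpt (m : MDP S A) (v : S → ℝ) (s : S) : ℝ :=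
  ⨆ a, m.q v s a

/-- The expected discounted return of a trajectory of length `n`. -/
noncomputable def MDP.expRet (m : MDP S A) (π : S → A → ℝ) (n : ℕ) (s : S) : ℝ :=
  ∑ τ : Fin n → A × S, m.trajProb π s τ * m.ret s τ

theorem sum_mul_le_of_mem_stdSimplex {ι : Type*} [Fintype ι] {p : ι → ℝ}
    (hp : p ∈ stdSimplex ℝ ι) {f : ι → ℝ} {c : ℝ} (h : ∀ i, f i ≤ c) : ∑ i, p i * f i ≤ c := by
  calc ∑ i, p i * f i ≤ ∑ i, p i * c :=
        Finset.sum_le_sum fun i _ => mul_le_mul_of_nonneg_left (h i) (hp.1 i)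
    _ = c := by rw [← Finset.sum_mul, hp.2, one_mul]

theorem le_sum_mul_of_mem_stdSimplex {ι : Type*} [Fintype ι] {p : ι → ℝ}
    (hp : p ∈ stdSimplex ℝ ι) {f : ι → ℝ} {c : ℝ} (h : ∀ i, c ≤ f i) : c ≤ ∑ i, p i * f i := by
  calc c = ∑ i, p i * c := by rw [← Finset.sum_mul, hp.2, one_mul]
    _ ≤ ∑ i, p i * f i :=
        Finset.sum_le_sum fun i _ => mul_le_mul_of_nonneg_left (h i) (hp.1 i)

/-- The one-sided form with an additive constant carries monotonicity (`c = 0`) and nonexpansiveness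
at once; the operator estimates inherit it. -/
theorem sum_mul_le_sum_mul_add {ι : Type*} [Fintype ι] {p : ι → ℝ}
    (hp : p ∈ stdSimplex ℝ ι) {f g : ι → ℝ} {c : ℝ} (h : ∀ i, f i ≤ g i + c) :
    ∑ i, p i * f i ≤ ∑ i, p i * g i + c := by
  have := sum_mul_le_of_mem_stdSimplex hp (f := fun i => f i - g i) (c := c)
    (fun i => by linarith [h i])
  simp only [mul_sub, Finset.sum_sub_distrib] at this
  linarith

variable (m : MDP S A)

theorem MDP.one_sub_pos : 0 < 1 - m.γ := sub_pos.2 m.γ_lt_one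

theorem MDP.q_le_q_add {v w : S → ℝ} {c : ℝ} (h : ∀ s, v s ≤ w s + c) (s : S) (a : A) :
    m.q v s a ≤ m.q w s a + m.γ * c := by
  have := mul_le_mul_of_nonneg_left (sum_mul_le_sum_mul_add (m.P_mem s a) h) m.γ_pos.le
  unfold MDP.q
  linarith

theorem MDP.bellPol_le_bellPol_add {π : S → A → ℝ} (hπ : IsPolicy π) {v w : S → ℝ} {c : ℝ}
    (h : ∀ s, v s ≤ w s + c) (s : S) : m.bellPol π v s ≤ m.bellPol π w s + m.γ * c :=
  sum_mul_le_sum_mul_add (hπ s) fun a => m.q_le_q_add h s a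

theorem le_iSup_of_fintype {ι : Type*} [Finite ι] (f : ι → ℝ) (i : ι) : f i ≤ ⨆ j, f j :=
  le_ciSup (Set.finite_range f).bddAbove i

theorem MDP.bellPol_le_bellOpt {π : S → A → ℝ} (hπ : IsPolicy π) (v : S → ℝ) (s : S) :
    m.bellPol π v s ≤ m.bellOpt v s :=
  sum_mul_le_of_mem_stdSimplex (hπ s) fun a => le_iSup_of_fintype (fun a => m.q v s a) a

theorem iSup_le_iSup_add {ι : Type*} [Finite ι] [Nonempty ι] {f g : ι → ℝ} {c : ℝ}
    (h : ∀ i, f i ≤ g i + c) : ⨆ i, f i ≤ (⨆ i, g i) + c :=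
  ciSup_le fun i => (h i).trans (by linarith [le_iSup_of_fintype g i])

theorem MDP.bellOpt_le_bellOpt_add [Nonempty A] {v w : S → ℝ} {c : ℝ}
    (h : ∀ s, v s ≤ w s + c) (s : S) : m.bellOpt v s ≤ m.bellOpt w s + m.γ * c :=
  iSup_le_iSup_add fun a => m.q_le_q_add h s a

theorem MDP.bellOpt_mono [Nonempty A] {v w : S → ℝ} (h : ∀ s, v s ≤ w s) (s : S) :
    m.bellOpt v s ≤ m.bellOpt w s := by
  simpa using m.bellOpt_le_bellOpt_add (c := 0) (by simpa using h) s

theorem MDP.iterate_bellOpt_le_add [Nonempty A] {v w : S → ℝ} {c : ℝ}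
    (h : ∀ s, v s ≤ w s + c) (n : ℕ) (s : S) :
    m.bellOpt^[n] v s ≤ m.bellOpt^[n] w s + m.γ ^ n * c := by
  induction n generalizing s with
  | zero => simpa using h s
  | succ n ih =>
    rw [Function.iterate_succ_apply', Function.iterate_succ_apply', pow_succ', mul_assoc]
    exact m.bellOpt_le_bellOpt_add ih s

theorem MDP.le_bellOpt_iterate [Nonempty A] {v : S → ℝ} (h : ∀ s, v s ≤ m.bellOpt v s)
    (n : ℕ) (s : S) : m.bellOpt^[n] v s ≤ m.bellOpt^[n + 1] v s := by
  induction n generalizing s with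
  | zero => exact h s
  | succ n ih =>
    rw [Function.iterate_succ_apply', Function.iterate_succ_apply' _ (n + 1)]
    exact m.bellOpt_mono ih s

theorem MDP.le_iterate_bellOpt [Nonempty A] {v : S → ℝ} (h : ∀ s, v s ≤ m.bellOpt v s)
    (n : ℕ) (s : S) : v s ≤ m.bellOpt^[n] v s := by
  induction n with
  | zero => exact le_rfl
  | succ n ih => exact ih.trans (m.le_bellOpt_iterate h n s)

end BellmanOperators

/-! ### First-step analysis of trajectories and value functions. -/

section FirstStep

theorem visited_cons {S : Type u} {A : Type v} {n : ℕ} (s : S) (x : A × S) (τ : Fin n → A × S) :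
    visited s (Fin.cons x τ : Fin (n + 1) → A × S) = Fin.cons s (visited x.2 τ) := by
  funext i
  refine Fin.cases rfl (fun j => ?_) i
  refine Fin.cases rfl (fun j => ?_) j
  simp [visited]

variable {S : Type u} {A : Type v} [Fintype S] [Fintype A] (m : MDP S A)

theorem MDP.trajProb_cons (π : S → A → ℝ) {n : ℕ} (s : S) (x : A × S) (τ : Fin n → A × S) :
    m.trajProb π s (Fin.cons x τ : Fin (n + 1) → A × S) =
      π s x.1 * m.P s x.1 x.2 * m.trajProb π x.2 τ := by
  unfold MDP.trajProb
  rw [Fin.prod_univ_succ]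
  simp only [visited_cons, Fin.castSucc_zero, Fin.cons_zero, Fin.cons_succ, ← Fin.succ_castSucc]
  rfl

theorem MDP.ret_cons {n : ℕ} (s : S) (x : A × S) (τ : Fin n → A × S) :
    m.ret s (Fin.cons x τ : Fin (n + 1) → A × S) = m.r s x.1 + m.γ * m.ret x.2 τ := by
  unfold MDP.ret
  rw [Fin.sum_univ_succ, Finset.mul_sum]
  simp only [visited_cons, Fin.castSucc_zero, Fin.cons_zero, Fin.cons_succ, ← Fin.succ_castSucc,
    Fin.val_zero, Fin.val_succ, pow_zero, one_mul, pow_succ', mul_assoc]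

theorem sum_fin_succ_fun {α : Type*} [Fintype α] {n : ℕ} (f : (Fin (n + 1) → α) → ℝ) :
    ∑ τ, f τ = ∑ x, ∑ τ : Fin n → α, f (Fin.cons x τ) := by
  rw [← (Fin.consEquiv fun _ : Fin (n + 1) => α).sum_comp f, Fintype.sum_prod_type]
  rfl

theorem MDP.trajProb_nonneg {π : S → A → ℝ} (hπ : IsPolicy π) {n : ℕ} (s : S)
    (τ : Fin n → A × S) : 0 ≤ m.trajProb π s τ :=
  Finset.prod_nonneg fun _ _ => mul_nonneg ((hπ _).1 _) ((m.P_mem _ _).1 _)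

theorem MDP.sum_trajProb {π : S → A → ℝ} (hπ : IsPolicy π) (n : ℕ) (s : S) :
    ∑ τ : Fin n → A × S, m.trajProb π s τ = 1 := by
  induction n generalizing s with
  | zero => simp [MDP.trajProb]
  | succ n ih =>
    rw [sum_fin_succ_fun]
    simp only [MDP.trajProb_cons, ← Finset.mul_sum, ih, mul_one, Fintype.sum_prod_type,
      (m.P_mem _ _).2, (hπ s).2]

theorem MDP.expRet_zero (π : S → A → ℝ) (s : S) : m.expRet π 0 s = 0 := by
  simp [MDP.expRet, MDP.ret]

/-- Conditioning on the first action and next state: the first reward factors out because the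
remaining trajectory has total mass one. -/
theorem MDP.expRet_succ {π : S → A → ℝ} (hπ : IsPolicy π) (n : ℕ) (s : S) :
    m.expRet π (n + 1) s = m.bellPol π (m.expRet π n) s := by
  unfold MDP.bellPol MDP.q
  rw [MDP.expRet, sum_fin_succ_fun, Fintype.sum_prod_type]
  refine Finset.sum_congr rfl fun a _ => ?_
  have h1 : ∀ s', ∑ τ : Fin n → A × S, m.trajProb π s (Fin.cons (a, s') τ : Fin (n + 1) → A × S) *
      m.ret s (Fin.cons (a, s') τ : Fin (n + 1) → A × S) =
      π s a * (m.P s a s' * m.r s a + m.γ * (m.P s a s' * m.expRet π n s')) := by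
    intro s'
    have h2 := m.sum_trajProb hπ n s'
    simp only [MDP.trajProb_cons, MDP.ret_cons]
    calc _ = ∑ τ : Fin n → A × S, (π s a * m.P s a s' * m.r s a * m.trajProb π s' τ +
          π s a * m.P s a s' * m.γ * (m.trajProb π s' τ * m.ret s' τ)) :=
          Finset.sum_congr rfl fun τ _ => by ring
      _ = _ := by
        rw [Finset.sum_add_distrib, ← Finset.mul_sum, ← Finset.mul_sum, h2]
        unfold MDP.expRet
        ring
  simp only [h1]
  rw [← Finset.mul_sum, Finset.sum_add_distrib, ← Finset.sum_mul, (m.P_mem s a).2,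
    ← Finset.mul_sum, one_mul]

theorem MDP.expReward_zero (π : S → A → ℝ) (s : S) :
    m.expReward π s 0 = ∑ a, π s a * m.r s a := by
  unfold MDP.expReward
  rw [sum_fin_succ_fun, Fintype.sum_prod_type]
  refine Finset.sum_congr rfl fun a _ => ?_
  simp only [MDP.trajProb_cons, visited_cons]
  simp [MDP.trajProb, ← Finset.mul_sum, ← Finset.sum_mul, (m.P_mem s a).2]

theorem MDP.expReward_succ (π : S → A → ℝ) (s : S) (t : ℕ) :
    m.expReward π s (t + 1) = ∑ a, π s a * ∑ s', m.P s a s' * m.expReward π s' t := by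
  unfold MDP.expReward
  rw [sum_fin_succ_fun, Fintype.sum_prod_type]
  refine Finset.sum_congr rfl fun a _ => ?_
  rw [Finset.mul_sum]
  refine Finset.sum_congr rfl fun s' _ => ?_
  rw [Finset.mul_sum, Finset.mul_sum]
  refine Finset.sum_congr rfl fun τ _ => ?_
  rw [MDP.trajProb_cons, visited_cons, ← Fin.succ_last, ← Fin.succ_castSucc, Fin.cons_succ,
    Fin.cons_succ]
  ring

theorem MDP.expReward_mem {π : S → A → ℝ} (hπ : IsPolicy π) (s : S) (t : ℕ) :
    m.expReward π s t ∈ Set.Icc (0 : ℝ) 1 := by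
  induction t generalizing s with
  | zero =>
    rw [MDP.expReward_zero]
    exact ⟨le_sum_mul_of_mem_stdSimplex (hπ s) fun a => (m.r_mem s a).1,
      sum_mul_le_of_mem_stdSimplex (hπ s) fun a => (m.r_mem s a).2⟩
  | succ t ih =>
    rw [MDP.expReward_succ]
    exact ⟨le_sum_mul_of_mem_stdSimplex (hπ s) fun a =>
        le_sum_mul_of_mem_stdSimplex (m.P_mem s a) fun s' => (ih s').1,
      sum_mul_le_of_mem_stdSimplex (hπ s) fun a =>
        sum_mul_le_of_mem_stdSimplex (m.P_mem s a) fun s' => (ih s').2⟩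

theorem MDP.summable_expReward {π : S → A → ℝ} (hπ : IsPolicy π) (s : S) :
    Summable fun t => m.γ ^ t * m.expReward π s t :=
  Summable.of_nonneg_of_le
    (fun t => mul_nonneg (pow_nonneg m.γ_pos.le t) (m.expReward_mem hπ s t).1)
    (fun t => mul_le_of_le_one_right (pow_nonneg m.γ_pos.le t) (m.expReward_mem hπ s t).2)
    (summable_geometric_of_lt_one m.γ_pos.le m.γ_lt_one)

theorem MDP.V_nonneg {π : S → A → ℝ} (hπ : IsPolicy π) (s : S) : 0 ≤ m.V π s :=
  tsum_nonneg fun t => mul_nonneg (pow_nonneg m.γ_pos.le t) (m.expReward_mem hπ s t).1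

theorem MDP.V_le {π : S → A → ℝ} (hπ : IsPolicy π) (s : S) : m.V π s ≤ 1 / (1 - m.γ) := by
  rw [one_div, ← tsum_geometric_of_lt_one m.γ_pos.le m.γ_lt_one]
  exact (m.summable_expReward hπ s).tsum_le_tsum
    (fun t => mul_le_of_le_one_right (pow_nonneg m.γ_pos.le t) (m.expReward_mem hπ s t).2)
    (summable_geometric_of_lt_one m.γ_pos.le m.γ_lt_one)

theorem MDP.V_eq_bellPol {π : S → A → ℝ} (hπ : IsPolicy π) (s : S) :
    m.V π s = m.bellPol π (m.V π) s := by
  -- The series without its first term is, by the first-step recursion, a finite combination of the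
  -- value series started at the successors.
  have h1 : HasSum (fun t => m.γ ^ (t + 1) * m.expReward π s (t + 1))
      (∑ a, π s a * ∑ s', m.P s a s' * (m.γ * m.V π s')) := by
    have h2 := hasSum_sum (s := Finset.univ) fun a _ => (hasSum_sum (s := Finset.univ) fun s' _ =>
      (((m.summable_expReward hπ s').hasSum.mul_left m.γ).mul_left (m.P s a s'))).mul_left (π s a)
    refine h2.congr_fun fun t => ?_
    rw [MDP.expReward_succ, Finset.mul_sum]
    refine Finset.sum_congr rfl fun a _ => ?_
    simp only [Finset.mul_sum]
    refine Finset.sum_congr rfl fun s' _ => ?_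
    ring
  rw [MDP.V, (m.summable_expReward hπ s).tsum_eq_zero_add, h1.tsum_eq, MDP.expReward_zero,
    pow_zero, one_mul, ← Finset.sum_add_distrib]
  refine Finset.sum_congr rfl fun a _ => ?_
  rw [MDP.q, mul_add, Finset.mul_sum (a := m.γ)]
  congr 2
  exact Finset.sum_congr rfl fun s' _ => by ring

/-- V^π is a fixed point of the policy's Bellman operator and the truncated return is its n-fold
iterate from 0, so each step contracts the gap by γ. -/
theorem MDP.abs_V_sub_expRet_le {π : S → A → ℝ} (hπ : IsPolicy π) (n : ℕ) (s : S) :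
    |m.V π s - m.expRet π n s| ≤ m.γ ^ n / (1 - m.γ) := by
  rw [abs_le]
  induction n generalizing s with
  | zero =>
    rw [MDP.expRet_zero, pow_zero, sub_zero]
    have := one_div_nonneg.2 m.one_sub_pos.le
    exact ⟨by linarith [m.V_nonneg hπ s], m.V_le hπ s⟩
  | succ n ih =>
    rw [MDP.expRet_succ m hπ, m.V_eq_bellPol hπ, pow_succ', mul_div_assoc]
    have h1 := m.bellPol_le_bellPol_add hπ (v := m.V π) (w := m.expRet π n)
      (c := m.γ ^ n / (1 - m.γ)) (fun s => by linarith [(ih s).2]) s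
    have h2 := m.bellPol_le_bellPol_add hπ (v := m.expRet π n) (w := m.V π)
      (c := m.γ ^ n / (1 - m.γ)) (fun s => by linarith [(ih s).1]) s
    constructor <;> linarith

theorem MDP.ret_mem {n : ℕ} (s : S) (τ : Fin n → A × S) :
    m.ret s τ ∈ Set.Icc (0 : ℝ) (1 / (1 - m.γ)) := by
  refine ⟨Finset.sum_nonneg fun t _ => mul_nonneg (pow_nonneg m.γ_pos.le _) (m.r_mem _ _).1, ?_⟩
  calc m.ret s τ ≤ ∑ t : Fin n, m.γ ^ (t : ℕ) := Finset.sum_le_sum fun t _ =>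
        mul_le_of_le_one_right (pow_nonneg m.γ_pos.le _) (m.r_mem _ _).2
    _ = ∑ t ∈ Finset.range n, m.γ ^ t := Fin.sum_univ_eq_sum_range (fun t => m.γ ^ t) n
    _ ≤ ∑' t : ℕ, m.γ ^ t :=
        (summable_geometric_of_lt_one m.γ_pos.le m.γ_lt_one).sum_le_tsum _
          fun t _ => pow_nonneg m.γ_pos.le t
    _ = 1 / (1 - m.γ) := by rw [tsum_geometric_of_lt_one m.γ_pos.le m.γ_lt_one, one_div]

end FirstStep

/-! ### Approximate policy improvement with lookahead. -/

section Improvement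

variable {S : Type u} {A : Type v} [Fintype S] [Fintype A] (m : MDP S A)

theorem MDP.V_le_bellOpt {π : S → A → ℝ} (hπ : IsPolicy π) (s : S) :
    m.V π s ≤ m.bellOpt (m.V π) s :=
  (m.V_eq_bellPol hπ s).trans_le (m.bellPol_le_bellOpt hπ _ s)

theorem MDP.V_le_Vstar {π : S → A → ℝ} (hπ : IsPolicy π) (s : S) : m.V π s ≤ m.Vstar s :=
  le_ciSup (f := fun π : {π : S → A → ℝ // IsPolicy π} => m.V π.1 s)
    ⟨1 / (1 - m.γ), by rintro _ ⟨π, rfl⟩; exact m.V_le π.2 s⟩ ⟨π, hπ⟩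

theorem MDP.Vstar_le {π : S → A → ℝ} (hπ : IsPolicy π) {s : S} {c : ℝ}
    (h : ∀ π', IsPolicy π' → m.V π' s ≤ c) : m.Vstar s ≤ c :=
  have : Nonempty {π : S → A → ℝ // IsPolicy π} := ⟨⟨π, hπ⟩⟩
  ciSup_le fun π => h π.1 π.2

/-- For every policy V^π' ≤ T V^π' ≤ T V⋆. This half of the Bellman equation is enough, so neither
an optimal policy nor a fixed point theorem enters. -/
theorem MDP.Vstar_le_bellOpt [Nonempty A] {π : S → A → ℝ} (hπ : IsPolicy π) (s : S) :
    m.Vstar s ≤ m.bellOpt m.Vstar s :=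
  m.Vstar_le hπ fun _ hπ' => (m.V_le_bellOpt hπ' s).trans
    (m.bellOpt_mono (fun s => m.V_le_Vstar hπ' s) s)

theorem MDP.norm_Vstar_sub_le {π : S → A → ℝ} (hπ : IsPolicy π) {c : ℝ} (hc : 0 ≤ c)
    (h : ∀ s, m.Vstar s ≤ m.V π s + c) : ‖m.Vstar - m.V π‖ ≤ c := by
  rw [pi_norm_le_iff_of_nonneg hc]
  intro s
  rw [Pi.sub_apply, Real.norm_eq_abs, abs_le]
  constructor <;> linarith [h s, m.V_le_Vstar hπ s]

theorem MDP.Vstar_le_add_norm (π : S → A → ℝ) (s : S) :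
    m.Vstar s ≤ m.V π s + ‖m.Vstar - m.V π‖ := by
  have := (le_abs_self _).trans (norm_le_pi_norm (m.Vstar - m.V π) s)
  rw [Pi.sub_apply] at this
  linarith

theorem MDP.norm_Vstar_sub_le_one_div {π : S → A → ℝ} (hπ : IsPolicy π) :
    ‖m.Vstar - m.V π‖ ≤ 1 / (1 - m.γ) :=
  m.norm_Vstar_sub_le hπ (one_div_nonneg.2 m.one_sub_pos.le) fun s =>
    m.Vstar_le hπ fun π' hπ' => by linarith [m.V_le hπ' s, m.V_nonneg hπ s]

/-- A policy that is nearly greedy for a vector which increases under the Bellman optimality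
operator is nearly as good as that operator. -/
theorem MDP.bellOpt_le_V_add {π : S → A → ℝ} (hπ : IsPolicy π) {v : S → ℝ} {e : ℝ}
    (hv : ∀ s, v s ≤ m.bellOpt v s) (h : ∀ s, m.bellOpt v s ≤ m.bellPol π v s + e) (s : S) :
    m.bellOpt v s ≤ m.V π s + e / (1 - m.γ) := by
  have : Nonempty S := ⟨s⟩
  -- At the state with the largest gap d, v ≤ T v ≤ V^π + d and near-greediness give d ≤ γ d + e.
  obtain ⟨s₀, h₀⟩ := Finite.exists_max fun s => m.bellOpt v s - m.V π s
  have h1 : ∀ s, v s ≤ m.V π s + (m.bellOpt v s₀ - m.V π s₀) := fun s => by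
    linarith [h₀ s, hv s]
  have h2 := m.bellPol_le_bellPol_add hπ h1 s₀
  rw [← m.V_eq_bellPol hπ] at h2
  have h3 : m.bellOpt v s₀ - m.V π s₀ ≤ e / (1 - m.γ) := by
    rw [le_div_iff₀ m.one_sub_pos]
    linarith [h s₀]
  linarith [h₀ s]

/-- One step of approximate policy iteration with lookahead depth `n + 1`. -/
theorem MDP.norm_Vstar_sub_lookahead_le [Nonempty A] {π π' : S → A → ℝ} (hπ : IsPolicy π)
    (hπ' : IsPolicy π') (n : ℕ) {e : ℝ} (he : 0 ≤ e)
    (h : ∀ s, m.bellOpt (m.bellOpt^[n] (m.V π)) s ≤ m.bellPol π' (m.bellOpt^[n] (m.V π)) s + e) :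
    ‖m.Vstar - m.V π'‖ ≤ m.γ ^ (n + 1) * ‖m.Vstar - m.V π‖ + e / (1 - m.γ) := by
  refine m.norm_Vstar_sub_le hπ' (add_nonneg (mul_nonneg (pow_nonneg m.γ_pos.le _)
    (norm_nonneg _)) (div_nonneg he m.one_sub_pos.le)) fun s => ?_
  have h1 := m.le_iterate_bellOpt (m.Vstar_le_bellOpt hπ) (n + 1) s
  have h2 := m.iterate_bellOpt_le_add (m.Vstar_le_add_norm π) (n + 1) s
  have h3 := m.bellOpt_le_V_add hπ' (v := m.bellOpt^[n] (m.V π)) (fun s => by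
    have := m.le_bellOpt_iterate (m.V_le_bellOpt hπ) n s
    rwa [Function.iterate_succ_apply'] at this) h s
  rw [Function.iterate_succ_apply' _ n (m.V π)] at h2
  linarith

end Improvement

end HPMD

namespace HPMD

/-! ### Convexity and steepness of the mirror map. -/

section MirrorMap

variable {A : Type v} [Fintype A]

/-- The gradient inequality of a convex function. -/
theorem convexOn_add_fderiv_le {E : Type*} [NormedAddCommGroup E] [NormedSpace ℝ E]
    {s : Set E} {f : E → ℝ} (hf : ConvexOn ℝ s f) {x y : E} (hx : x ∈ s) (hy : y ∈ s)
    (hd : DifferentiableAt ℝ f x) : f x + fderiv ℝ f x (y - x) ≤ f y := by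
  have h1 : ConvexOn ℝ (Set.Icc (0 : ℝ) 1) (f ∘ AffineMap.lineMap x y) := by
    refine (hf.comp_affineMap (AffineMap.lineMap x y)).subset (fun t ht => ?_) (convex_Icc 0 1)
    exact hf.1.segment_subset hx hy (by
      rw [segment_eq_image_lineMap]; exact Set.mem_image_of_mem _ ht)
  have h2 : HasDerivAt (f ∘ (AffineMap.lineMap x y : ℝ → E)) (fderiv ℝ f x (y - x)) 0 := by
    refine HasFDerivAt.comp_hasDerivAt (0 : ℝ) ?_ AffineMap.hasDerivAt_lineMap
    rw [AffineMap.lineMap_apply_zero]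
    exact hd.hasFDerivAt
  have h3 := h1.le_slope_of_hasDerivAt (by simp) (by simp) zero_lt_one h2
  simp only [slope_def_field, Function.comp_apply, AffineMap.lineMap_apply_one,
    AffineMap.lineMap_apply_zero, sub_zero, div_one] at h3
  linarith

theorem IsMirrorMap.bregman_nonneg {φ : (A → ℝ) → ℝ} {dom : Set (A → ℝ)}
    (hφ : IsMirrorMap φ dom) {p q : A → ℝ} (hp : p ∈ dom) (hq : q ∈ interior dom) :
    0 ≤ bregman φ p q := by
  have := convexOn_add_fderiv_le hφ.convexOn (interior_subset hq) hp (hφ.differentiableAt q hq)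
  unfold bregman
  linarith

/-- Steepness keeps the minimizers over the simplex of the mirror map plus a linear function away
from the boundary of the domain. -/
theorem IsMirrorMap.mem_interior [Nonempty A] {φ : (A → ℝ) → ℝ} {dom : Set (A → ℝ)}
    (hφ : IsMirrorMap φ dom) (L : (A → ℝ) →ₗ[ℝ] ℝ) {p : A → ℝ} (hp : p ∈ stdSimplex ℝ A)
    (hmin : ∀ p' ∈ stdSimplex ℝ A, φ p + L (p' - p) ≤ φ p') : p ∈ interior dom := by
  by_contra hni
  have hpd := hφ.simplex_subset hp
  have hfr : p ∈ frontier dom := ⟨subset_closure hpd, hni⟩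
  set u : A → ℝ := fun _ => (Fintype.card A : ℝ)⁻¹ with hu_def
  have hc : (0 : ℝ) < Fintype.card A := by exact_mod_cast Fintype.card_pos
  have hu : u ∈ stdSimplex ℝ A := ⟨fun _ => (inv_pos.2 hc).le, by simp [hu_def, hc.ne']⟩
  have hui : u ∈ interior dom := hφ.relint_subset u hu fun _ => inv_pos.2 hc
  have hcont : ContinuousAt φ u := (hφ.differentiableAt u hui).continuousAt
  -- Plan: bound the gradient of `φ` uniformly along the segment from the uniform distribution `u`
  -- towards `p`, contradicting steepness at `p`. The ball around `u` supplies test directions.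
  obtain ⟨ρ, hρ, hball⟩ : ∃ ρ > 0, ∀ y, ‖y - u‖ ≤ ρ → y ∈ dom ∧ φ y ≤ φ u + 1 := by
    have h1 : ∀ᶠ y in 𝓝 u, y ∈ dom ∧ φ y ≤ φ u + 1 :=
      (Filter.Eventually.and (mem_interior_iff_mem_nhds.1 hui)
        ((hcont.eventually_lt continuousAt_const (by linarith : φ u < φ u + 1)).mono
          fun _ h => h.le))
    obtain ⟨ρ, hρ, h2⟩ := Metric.nhds_basis_closedBall.eventually_iff.1 h1
    exact ⟨ρ, hρ, fun y hy => h2 (by rwa [Metric.mem_closedBall, dist_eq_norm])⟩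
  set x : ℝ → A → ℝ := fun t => p + t • (u - p) with hx_def
  set c := L (u - p) with hc_def
  have hxs : ∀ t ∈ Set.Ioc (0 : ℝ) 1, x t ∈ stdSimplex ℝ A := fun t ht =>
    (convex_stdSimplex ℝ A).add_smul_sub_mem hp hu ⟨ht.1.le, ht.2⟩
  have hxi : ∀ t ∈ Set.Ioc (0 : ℝ) 1, x t ∈ interior dom := by
    intro t ht
    have := hφ.convexOn.1.combo_self_interior_mem_interior hpd hui (a := 1 - t) (b := t)
      (by linarith [ht.2]) ht.1 (by ring)
    convert this using 1
    simp only [hx_def]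
    module
  have hlow : ∀ t ∈ Set.Ioc (0 : ℝ) 1, φ p + t * c ≤ φ (x t) := by
    intro t ht
    have := hmin _ (hxs t ht)
    rwa [show x t - p = t • (u - p) by simp [hx_def], map_smul, smul_eq_mul] at this
  -- The gradient inequality from `x t` back to `p`, set against minimality of `p`, bounds the slope
  -- along the segment from below.
  have hgrad : ∀ t ∈ Set.Ioc (0 : ℝ) 1, c ≤ fderiv ℝ φ (x t) (u - p) := by
    intro t ht
    have h1 := convexOn_add_fderiv_le hφ.convexOn (interior_subset (hxi t ht)) hpd
      (hφ.differentiableAt _ (hxi t ht))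
    rw [show p - x t = -(t • (u - p)) by simp [hx_def], map_neg, map_smul, smul_eq_mul] at h1
    have h2 := hlow t ht
    exact le_of_mul_le_mul_left (by linarith) ht.1
  have hbound : ∀ t ∈ Set.Ioc (0 : ℝ) 1,
      ‖fderiv ℝ φ (x t)‖ ≤ (φ u + 1 - φ p + 2 * |c|) / ρ := by
    intro t ht
    -- Gradient inequality from `x t` to `u + v`: the component along `u - p` is controlled by
    -- `hgrad` and `φ (x t)` by `hlow`, each at a cost of at most `|c|`.
    have key : ∀ v : A → ℝ, ‖v‖ ≤ ρ → fderiv ℝ φ (x t) v ≤ φ u + 1 - φ p + 2 * |c| := by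
      intro v hv
      obtain ⟨hd, hle⟩ := hball (u + v) (by simpa using hv)
      have h1 := convexOn_add_fderiv_le hφ.convexOn (interior_subset (hxi t ht)) hd
        (hφ.differentiableAt _ (hxi t ht))
      rw [show u + v - x t = v + (1 - t) • (u - p) by simp only [hx_def]; module, map_add,
        map_smul, smul_eq_mul] at h1
      have h2 := hlow t ht
      have h3 := mul_le_mul_of_nonneg_left (hgrad t ht) (sub_nonneg.2 ht.2)
      have h4 := neg_abs_le c
      have h5 : -|c| ≤ t * c := by nlinarith [ht.1, ht.2, abs_nonneg c]
      have h6 : -|c| ≤ (1 - t) * c := by nlinarith [ht.1, ht.2, abs_nonneg c]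
      linarith
    have hB : 0 ≤ φ u + 1 - φ p + 2 * |c| := by simpa using key 0 (by simpa using hρ.le)
    refine ContinuousLinearMap.opNorm_le_bound _ (div_nonneg hB hρ.le) fun v => ?_
    rcases eq_or_ne v 0 with rfl | hv
    · simp
    have hv' := norm_pos_iff.2 hv
    have hn : ‖(ρ / ‖v‖) • v‖ ≤ ρ := by
      rw [norm_smul, norm_div, norm_norm, Real.norm_of_nonneg hρ.le, div_mul_cancel₀ _ hv'.ne']
    have h1 := key _ hn
    have h2 := key (-((ρ / ‖v‖) • v)) (by rwa [norm_neg])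
    rw [map_neg, map_smul, smul_eq_mul, ← mul_neg] at h2
    rw [map_smul, smul_eq_mul] at h1
    rw [Real.norm_eq_abs, div_mul_eq_mul_div, le_div_iff₀ hρ, ← div_le_iff₀ hv', mul_div_assoc]
    rcases abs_cases (fderiv ℝ φ (x t) v) with ⟨h, _⟩ | ⟨h, _⟩ <;> rw [h, mul_comm] <;> assumption
  have htend : Tendsto x (𝓝[>] 0) (𝓝[interior dom] p) := by
    refine tendsto_nhdsWithin_iff.2 ⟨?_, ?_⟩
    · have : Continuous x := by fun_prop
      have h := this.tendsto 0
      simp only [hx_def, zero_smul, add_zero] at h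
      exact h.mono_left nhdsWithin_le_nhds
    · filter_upwards [Ioc_mem_nhdsGT (zero_lt_one' ℝ)] with t ht using hxi t ht
  have h1 := ((hφ.steep p hfr).comp htend).eventually_gt_atTop
    ((φ u + 1 - φ p + 2 * |c|) / ρ)
  obtain ⟨t, h2, ht⟩ := (h1.and (Ioc_mem_nhdsGT (zero_lt_one' ℝ))).exists
  exact absurd (hbound t ht) (not_le.2 h2)

end MirrorMap

/-! ### The mirror descent update is nearly greedy. -/

section Update

variable {S : Type u} {A : Type v} [Fintype A]

theorem greedy_nonempty [Nonempty A] (Q : S → A → ℝ) : (greedy Q).Nonempty := by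
  classical
  choose f hf using fun s => Finite.exists_max (Q s)
  refine ⟨fun s => Pi.single (f s) 1, fun s => single_mem_stdSimplex ℝ _, fun π' hπ' s => ?_⟩
  have : ∑ a, (Pi.single (f s) 1 : A → ℝ) a * Q s a = Q s (f s) := by
    simp [Pi.single_apply]
  rw [this]
  exact sum_mul_le_of_mem_stdSimplex (hπ' s) (hf s)

theorem le_of_mem_greedy {Q π : S → A → ℝ} (hπ : π ∈ greedy Q) (s : S) (a : A) :
    Q s a ≤ ∑ b, π s b * Q s b := by
  classical
  simpa [Pi.single_apply] using
    hπ.2 (fun _ => Pi.single a 1) (fun _ => single_mem_stdSimplex ℝ a) s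

variable [Nonempty A] {φ : (A → ℝ) → ℝ} {dom : Set (A → ℝ)} {Q π π' : S → A → ℝ}
  {η : ℝ}

/-- The Bregman term differs from `φ` by an affine function, so the update minimizes `φ` plus an
affine function and steepness applies. This keeps the next Bregman divergence based at a point of
differentiability. -/
theorem IsMirrorMap.update_mem_interior (hφ : IsMirrorMap φ dom) (hπ' : IsPolicy π')
    (hmax : ∀ s, IsMaxOn (fun p : A → ℝ => η * ∑ a, Q s a * p a - bregman φ p (π s))
      (stdSimplex ℝ A) (π' s)) (s : S) : π' s ∈ interior dom := by
  refine hφ.mem_interior (η • (∑ a, Q s a • LinearMap.proj a) + (fderiv ℝ φ (π s)).toLinearMap)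
    (hπ' s) fun p hp => ?_
  have := hmax s hp
  simp only [Set.mem_ofPred_eq, bregman, map_sub] at this
  simp only [LinearMap.add_apply, LinearMap.smul_apply, LinearMap.sum_apply, LinearMap.proj_apply,
    smul_eq_mul, ContinuousLinearMap.coe_coe, map_sub]
  linarith

variable [Fintype S]

/-- With the adaptive step size, the updated policy is nearly greedy. -/
theorem IsMirrorMap.le_update_add (hφ : IsMirrorMap φ dom) (hπ : ∀ s, π s ∈ interior dom)
    (hπ' : IsPolicy π') (hη : 0 < η) {c : ℝ} (hc : 0 < c)
    (hstep : 1 / c * ‖minDiv φ Q π‖ ≤ η)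
    (hmax : ∀ s, IsMaxOn (fun p : A → ℝ => η * ∑ a, Q s a * p a - bregman φ p (π s))
      (stdSimplex ℝ A) (π' s)) (s : S) (a : A) :
    Q s a ≤ ∑ b, π' s b * Q s b + c := by
  -- Maximality of `π' s` against the competitor `ρ s`, dropping the nonnegative divergence of `π'
  -- s`.
  have h1 : ∀ ρ ∈ greedy Q, η * (Q s a - ∑ b, π' s b * Q s b) ≤ bregman φ (ρ s) (π s) := by
    intro ρ hρ
    have h2 := hmax s (hρ.1 s)
    have h3 := hφ.bregman_nonneg (hφ.simplex_subset (hπ' s)) (hπ s)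
    have h4 := mul_le_mul_of_nonneg_left (le_of_mem_greedy hρ s a) hη.le
    simp only [Set.mem_ofPred_eq, mul_comm (Q s _)] at h2
    linarith
  have h5 : η * (Q s a - ∑ b, π' s b * Q s b) ≤ minDiv φ Q π s :=
    le_csInf ((greedy_nonempty Q).image _) (by rintro _ ⟨ρ, hρ, rfl⟩; exact h1 ρ hρ)
  have h6 : minDiv φ Q π s ≤ ‖minDiv φ Q π‖ := (le_abs_self _).trans (norm_le_pi_norm (minDiv φ Q π) s)
  rw [one_div, inv_mul_le_iff₀ hc] at hstep
  have h7 : η * (Q s a - ∑ b, π' s b * Q s b) ≤ η * c := by linarith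
  linarith [le_of_mul_le_mul_left h7 hη]

end Update

end HPMD

namespace HPMD

/-! ### Propagation of sampling errors through the planning tree. -/

section Estimates

variable {S : Type u} {A : Type v} [Fintype S] [Fintype A] {h M M₀ H : ℕ} (m : MDP S A)

/-- Deviation of an empirical mean of the planning tree from the true mean, at level `k` and at a
state-action pair. -/
noncomputable def MDP.nodeErr (x : Samples S A h M M₀ H) (k : Fin h) (y : S × A) : ℝ :=
  (1 / (M : ℝ)) * ∑ j : Fin M, m.vHat x k k.2 (x.1 (k, y.1, y.2, j)) -
    ∑ s', m.P y.1 y.2 s' * m.vHat x k k.2 s'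

/-- The largest deviation at level `k` of the planning tree. -/
noncomputable def MDP.treeErr (x : Samples S A h M M₀ H) (k : Fin h) : ℝ :=
  ⨆ y : S × A, |m.nodeErr x k y|

/-- The largest deviation of a rollout average from the expected return. -/
noncomputable def MDP.rollErr (π : S → A → ℝ) (x : Samples S A h M M₀ H) : ℝ :=
  ⨆ s, |m.rolloutValue x s - m.expRet π H s|

/-- Bound on the error of the estimated lookahead action values. -/
noncomputable def MDP.estErr (π : S → A → ℝ) (x : Samples S A h M M₀ H) : ℝ :=
  ∑ j : Fin h, m.γ ^ (h - j : ℕ) * m.treeErr x j +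
    m.γ ^ h * (m.rollErr π x + m.γ ^ H / (1 - m.γ))

theorem MDP.treeErr_nonneg (x : Samples S A h M M₀ H) (k : Fin h) : 0 ≤ m.treeErr x k :=
  Real.iSup_nonneg fun _ => abs_nonneg _

theorem MDP.rollErr_nonneg (π : S → A → ℝ) (x : Samples S A h M M₀ H) : 0 ≤ m.rollErr π x :=
  Real.iSup_nonneg fun _ => abs_nonneg _

theorem MDP.estErr_nonneg (π : S → A → ℝ) (x : Samples S A h M M₀ H) : 0 ≤ m.estErr π x :=
  add_nonneg (Finset.sum_nonneg fun _ _ =>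
      mul_nonneg (pow_nonneg m.γ_pos.le _) (m.treeErr_nonneg _ _))
    (mul_nonneg (pow_nonneg m.γ_pos.le _) (add_nonneg (m.rollErr_nonneg _ _)
      (div_nonneg (pow_nonneg m.γ_pos.le _) m.one_sub_pos.le)))

theorem MDP.abs_backup_sub_q_le (x : Samples S A h M M₀ H) (k : Fin h) {v : S → ℝ} {c : ℝ}
    (hv : ∀ s, |m.vHat x k k.2 s - v s| ≤ c) (s : S) (a : A) :
    |m.backup x k (m.vHat x k k.2) s a - m.q v s a| ≤ m.γ * m.treeErr x k + m.γ * c := by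
  have h1 : |m.nodeErr x k (s, a)| ≤ m.treeErr x k :=
    le_iSup_of_fintype (fun y => |m.nodeErr x k y|) (s, a)
  have h2 : |∑ s', m.P s a s' * m.vHat x k k.2 s' - ∑ s', m.P s a s' * v s'| ≤ c := by
    have h3 := sum_mul_le_sum_mul_add (m.P_mem s a) (f := m.vHat x k k.2) (g := v) (c := c)
      fun s' => by linarith [(abs_le.1 (hv s')).2]
    have h4 := sum_mul_le_sum_mul_add (m.P_mem s a) (f := v) (g := m.vHat x k k.2) (c := c)
      fun s' => by linarith [(abs_le.1 (hv s')).1]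
    rw [abs_le]
    constructor <;> linarith
  have h3 : m.backup x k (m.vHat x k k.2) s a - m.q v s a = m.γ * (m.nodeErr x k (s, a) +
      (∑ s', m.P s a s' * m.vHat x k k.2 s' - ∑ s', m.P s a s' * v s')) := by
    simp only [MDP.backup, MDP.q, MDP.nodeErr]
    ring
  rw [h3, abs_mul, abs_of_pos m.γ_pos, ← mul_add]
  exact mul_le_mul_of_nonneg_left ((abs_add_le _ _).trans (add_le_add h1 h2)) m.γ_pos.le

theorem abs_iSup_sub_iSup_le {ι : Type*} [Finite ι] [Nonempty ι] {f g : ι → ℝ} {c : ℝ}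
    (hfg : ∀ i, |f i - g i| ≤ c) : |(⨆ i, f i) - ⨆ i, g i| ≤ c := by
  have h1 := iSup_le_iSup_add (f := f) (g := g) (c := c) fun i => by
    linarith [(abs_le.1 (hfg i)).2]
  have h2 := iSup_le_iSup_add (f := g) (g := f) (c := c) fun i => by
    linarith [(abs_le.1 (hfg i)).1]
  rw [abs_le]
  constructor <;> linarith

/-- Each backup multiplies the error from below by γ and adds γ times the deviation at its own
level. The sequence `z` stands for the level errors so that the sums can run over `Finset.range`. -/
theorem MDP.abs_vHat_sub_le [Nonempty A] {π : S → A → ℝ} (hπ : IsPolicy π)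
    (x : Samples S A h M M₀ H) {z : ℕ → ℝ} (hz : ∀ k : Fin h, m.treeErr x k = z k)
    (k : ℕ) (hk : k < h) (s : S) :
    |m.vHat x k hk s - m.bellOpt^[k] (m.V π) s| ≤
      ∑ j ∈ Finset.range k, m.γ ^ (k - j) * z j +
        m.γ ^ k * (m.rollErr π x + m.γ ^ H / (1 - m.γ)) := by
  induction k generalizing s with
  | zero =>
    have h1 := le_iSup_of_fintype (fun s => |m.rolloutValue x s - m.expRet π H s|) s
    have h2 := m.abs_V_sub_expRet_le hπ H s
    rw [abs_sub_comm] at h2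
    rw [Finset.sum_range_zero, zero_add, pow_zero, one_mul]
    exact (abs_sub_le (m.rolloutValue x s) (m.expRet π H s) (m.V π s)).trans (add_le_add h1 h2)
  | succ k ih =>
    rw [Function.iterate_succ_apply']
    have hk' := Nat.lt_of_succ_lt hk
    refine (abs_iSup_sub_iSup_le fun a => m.abs_backup_sub_q_le x ⟨k, hk'⟩ (ih hk') s a).trans ?_
    rw [hz, Finset.sum_range_succ, mul_add, Finset.mul_sum, Nat.add_sub_cancel_left, pow_one,
      pow_succ', mul_assoc]
    have : ∀ j ∈ Finset.range k, m.γ * (m.γ ^ (k - j) * z j) = m.γ ^ (k + 1 - j) * z j := by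
      intro j hj
      rw [Nat.succ_sub (Finset.mem_range.1 hj).le, pow_succ', mul_assoc]
    rw [Finset.sum_congr rfl this]
    linarith

theorem MDP.abs_qHat_sub_le [Nonempty A] {π : S → A → ℝ} (hπ : IsPolicy π) {n : ℕ}
    (hn : 0 < n + 1) (x : Samples S A (n + 1) M M₀ H) (s : S) (a : A) :
    |m.qHat hn x s a - m.q (m.bellOpt^[n] (m.V π)) s a| ≤ m.estErr π x := by
  -- The default 0 never occurs in the sums.
  set z : ℕ → ℝ := fun k => if hk : k < n + 1 then m.treeErr x ⟨k, hk⟩ else 0 with hz_def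
  have hz : ∀ k : Fin (n + 1), m.treeErr x k = z k := fun k => by
    simp only [hz_def, k.2, dif_pos]
  refine (m.abs_backup_sub_q_le x ⟨n, n.lt_succ_self⟩
    (m.abs_vHat_sub_le hπ x hz n n.lt_succ_self) s a).trans_eq ?_
  simp only [MDP.estErr, hz]
  rw [Fin.sum_univ_eq_sum_range (fun j => m.γ ^ (n + 1 - j) * z j) (n + 1),
    Finset.sum_range_succ, mul_add, Finset.mul_sum, Nat.add_sub_cancel_left, pow_one,
    pow_succ', mul_assoc]
  have : ∀ j ∈ Finset.range n, m.γ * (m.γ ^ (n - j) * z j) = m.γ ^ (n + 1 - j) * z j := by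
    intro j hj
    rw [Nat.succ_sub (Finset.mem_range.1 hj).le, pow_succ', mul_assoc]
  rw [Finset.sum_congr rfl this]
  ring

theorem average_mem_Icc {n : ℕ} {f : Fin n → ℝ} {b : ℝ} (hb : 0 ≤ b)
    (hf : ∀ i, f i ∈ Set.Icc 0 b) : (1 / (n : ℝ)) * ∑ i, f i ∈ Set.Icc 0 b := by
  refine ⟨mul_nonneg (by positivity) (Finset.sum_nonneg fun i _ => (hf i).1), ?_⟩
  rcases Nat.eq_zero_or_pos n with rfl | hn
  -- With no terms the average is 0, hence the need for `0 ≤ b`.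
  · simpa using hb
  · have h1 : ∑ i, f i ≤ n * b := by
      simpa using Finset.sum_le_card_nsmul Finset.univ f b fun i _ => (hf i).2
    rw [one_div, inv_mul_le_iff₀ (by exact_mod_cast hn)]
    exact h1

/-- Supplies the range for Hoeffding's lemma. Backups preserve the interval because 1 + γ/(1-γ) =
1/(1-γ). -/
theorem MDP.vHat_mem [Nonempty A] (x : Samples S A h M M₀ H) (k : ℕ) (hk : k < h) (s : S) :
    m.vHat x k hk s ∈ Set.Icc (0 : ℝ) (1 / (1 - m.γ)) := by
  have hb := one_div_nonneg.2 m.one_sub_pos.le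
  induction k generalizing s with
  | zero => exact average_mem_Icc hb fun j => m.ret_mem s _
  | succ k ih =>
    have hk' := Nat.lt_of_succ_lt hk
    have h1 : ∀ a, m.backup x ⟨k, hk'⟩ (m.vHat x k hk') s a ∈ Set.Icc (0 : ℝ) (1 / (1 - m.γ)) := by
      intro a
      have h2 := average_mem_Icc hb fun j : Fin M => ih hk' (x.1 (⟨k, hk'⟩, s, a, j))
      have h3 := m.r_mem s a
      have h4 : m.backup x ⟨k, hk'⟩ (m.vHat x k hk') s a = m.r s a +
          m.γ * (1 / (M : ℝ) * ∑ j : Fin M, m.vHat x k hk' (x.1 (⟨k, hk'⟩, s, a, j))) := by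
        rw [MDP.backup]; ring
      rw [h4]
      have h5 := mul_le_mul_of_nonneg_left h2.2 m.γ_pos.le
      have h6 : 1 + m.γ * (1 / (1 - m.γ)) = 1 / (1 - m.γ) := by
        have := m.one_sub_pos.ne'
        field_simp
        ring
      exact ⟨add_nonneg h3.1 (mul_nonneg m.γ_pos.le h2.1), by linarith [h3.2]⟩
    obtain ⟨a⟩ := ‹Nonempty A›
    exact ⟨(h1 a).1.trans (le_iSup_of_fintype
      (fun a => m.backup x ⟨k, hk'⟩ (m.vHat x k hk') s a) a), ciSup_le fun a => (h1 a).2⟩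

end Estimates

/-! ### The error recursion and its solution. -/

section Recursion

variable {S : Type u} {A : Type v} [Fintype S] [Fintype A] [Nonempty A] {h M M₀ H : ℕ}
  (m : MDP S A)

/-- One iteration of inexact policy mirror descent with lookahead. -/
theorem MDP.norm_Vstar_sub_update_le {φ : (A → ℝ) → ℝ} {dom : Set (A → ℝ)}
    (hφ : IsMirrorMap φ dom) (hh : 0 < h) {π π' : S → A → ℝ} (hπ : IsPolicy π)
    (hπi : ∀ s, π s ∈ interior dom) (hπ' : IsPolicy π') (x : Samples S A h M M₀ H) {η c : ℝ}
    (hη : 0 < η) (hc : 0 < c) (hstep : 1 / c * ‖minDiv φ (m.qHat hh x) π‖ ≤ η)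
    (hmax : ∀ s, IsMaxOn (fun p : A → ℝ => η * ∑ a, m.qHat hh x s a * p a - bregman φ p (π s))
      (stdSimplex ℝ A) (π' s)) :
    ‖m.Vstar - m.V π'‖ ≤ m.γ ^ h * ‖m.Vstar - m.V π‖ + (2 * m.estErr π x + c) / (1 - m.γ) := by
  obtain ⟨n, rfl⟩ : ∃ n, h = n + 1 := ⟨h - 1, by omega⟩
  refine m.norm_Vstar_sub_lookahead_le hπ hπ' n
    (add_nonneg (mul_nonneg zero_le_two (m.estErr_nonneg π x)) hc.le) fun s => ciSup_le fun a => ?_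
  -- Passing from exact to estimated values and back costs `estErr` twice.
  have h1 := abs_le.1 (m.abs_qHat_sub_le hπ hh x s a)
  have h2 := hφ.le_update_add hπi hπ' hη hc hstep hmax s a
  have h3 := sum_mul_le_sum_mul_add (hπ' s) (f := m.qHat hh x s)
    (g := m.q (m.bellOpt^[n] (m.V π)) s) (c := m.estErr π x)
    fun b => by linarith [(abs_le.1 (m.abs_qHat_sub_le hπ hh x s b)).2]
  unfold MDP.bellPol
  linarith

/-- The exponent 2(k+1) outpaces the contraction: ∑_{i<k} g^(k-1-i) g^(2(i+1)) = g^(k+1)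
(1-g^k)/(1-g), so the step-size errors decay like g^k too, with a factor g to spare. -/
theorem unroll_recursion {g γ : ℝ} (hg0 : 0 ≤ g) (hg1 : g < 1) (hγ : γ < 1) {a e : ℕ → ℝ} {K : ℕ}
    (hrec : ∀ k < K, a (k + 1) ≤ g * a k + (2 * e k + g ^ (2 * (k + 1))) / (1 - γ)) :
    ∀ k ≤ K, a k ≤ g ^ k * (a 0 + (1 - g ^ k) / ((1 - γ) * (1 - g))) +
      2 / (1 - γ) * ∑ i ∈ Finset.range k, g ^ (k - 1 - i) * e i := by
  intro k
  induction k with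
  | zero => intro _; simp
  | succ k ih =>
    intro hk
    have h1 := hrec k hk
    have h2 := mul_le_mul_of_nonneg_left (ih (Nat.le_of_succ_le hk)) hg0
    have hD : 0 < (1 - γ) * (1 - g) := mul_pos (sub_pos.2 hγ) (sub_pos.2 hg1)
    have h3 : g * (g ^ k * ((1 - g ^ k) / ((1 - γ) * (1 - g)))) + g ^ (2 * (k + 1)) / (1 - γ) ≤
        g ^ (k + 1) * ((1 - g ^ (k + 1)) / ((1 - γ) * (1 - g))) := by
      have h4 : g ^ (k + 1) * ((1 - g ^ (k + 1)) / ((1 - γ) * (1 - g))) -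
          (g * (g ^ k * ((1 - g ^ k) / ((1 - γ) * (1 - g)))) + g ^ (2 * (k + 1)) / (1 - γ)) =
          g ^ (2 * k + 1) * (1 - g) / (1 - γ) := by
        have := (sub_pos.2 hγ).ne'
        have := (sub_pos.2 hg1).ne'
        field_simp
        ring
      have h5 : 0 ≤ g ^ (2 * k + 1) * (1 - g) / (1 - γ) :=
        div_nonneg (mul_nonneg (pow_nonneg hg0 _) (sub_nonneg.2 hg1.le)) (sub_nonneg.2 hγ.le)
      linarith
    have h6 : ∑ i ∈ Finset.range (k + 1), g ^ (k + 1 - 1 - i) * e i =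
        e k + g * ∑ i ∈ Finset.range k, g ^ (k - 1 - i) * e i := by
      rw [Finset.sum_range_succ, Finset.mul_sum, add_comm]
      congr 1
      · simp
      · refine Finset.sum_congr rfl fun i hi => ?_
        have := Finset.mem_range.1 hi
        rw [← mul_assoc, ← pow_succ', show k - 1 - i + 1 = k + 1 - 1 - i by omega]
    rw [h6]
    have h7 : (2 * e k + g ^ (2 * (k + 1))) / (1 - γ) =
      2 / (1 - γ) * e k + g ^ (2 * (k + 1)) / (1 - γ) := by ring
    have h8 : g ^ (k + 1) * a 0 = g * (g ^ k * a 0) := by ring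
    rw [mul_add, mul_add]
    rw [mul_add, mul_add] at h2
    linarith

end Recursion

end HPMD

namespace HPMD

/-! ### Hoeffding's inequality for finite product distributions. -/

section FiniteProducts

theorem sum_prod_univ {C α : Type*} [Fintype C] [Fintype α] [DecidableEq C] (w : C → α → ℝ) :
    ∑ y : C → α, ∏ c, w c (y c) = ∏ c, ∑ a, w c a := by
  rw [Finset.prod_univ_sum, Fintype.piFinset_univ]

theorem sum_prod_eq_one {C α : Type*} [Fintype C] [Fintype α] [DecidableEq C] {w : C → α → ℝ}
    (hw : ∀ c, w c ∈ stdSimplex ℝ α) : ∑ y : C → α, ∏ c, w c (y c) = 1 := by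
  rw [sum_prod_univ]
  exact Finset.prod_eq_one fun c _ => (hw c).2

/-- Under a product distribution, the coordinates in `D` are integrated one by one, if the
integrand depends on the other coordinates only. -/
theorem sum_prod_mul_prod_le {C α : Type*} [Fintype C] [Fintype α] [Nonempty α] [DecidableEq C]
    {w : C → α → ℝ} (hw : ∀ c, w c ∈ stdSimplex ℝ α) (D : Finset C) {g : (C → α) → α → ℝ}
    (hg : ∀ y y', (∀ c ∉ D, y c = y' c) → g y = g y') (hg0 : ∀ y a, 0 ≤ g y a) {B : ℝ}
    (hB : ∀ y, ∀ c ∈ D, ∑ a, w c a * g y a ≤ B) :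
    ∑ y : C → α, (∏ c, w c (y c)) * ∏ c ∈ D, g y (y c) ≤ B ^ D.card := by
  obtain ⟨a₀⟩ := ‹Nonempty α›
  set e := Equiv.piEquivPiSubtypeProd (fun c => c ∈ D) (fun _ : C => α) with he
  have hin : ∀ u v (c : {c // c ∈ D}), e.symm (u, v) c = u c := fun u v c => by
    simp [he, Equiv.piEquivPiSubtypeProd]
  have hout : ∀ u v (c : {c // c ∉ D}), e.symm (u, v) c = v c := fun u v c => by
    simp [he, Equiv.piEquivPiSubtypeProd, c.2]
  -- Since `g` ignores the coordinates in `D`, they may be frozen at an arbitrary `a₀`.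
  set G : ({c // c ∉ D} → α) → α → ℝ := fun v => g (e.symm (fun _ => a₀, v)) with hG
  have hgG : ∀ u v, g (e.symm (u, v)) = G v := fun u v => hg _ _ fun c hc => by
    rw [hout u v ⟨c, hc⟩, hout _ v ⟨c, hc⟩]
  have h1 : ∀ u v, (∏ c, w c (e.symm (u, v) c)) * ∏ c ∈ D, g (e.symm (u, v)) (e.symm (u, v) c) =
      (∏ c : {c // c ∉ D}, w c (v c)) * ∏ c : {c // c ∈ D}, w c (u c) * G v (u c) := by
    intro u v
    have h2 : ∏ c, w c (e.symm (u, v) c) = (∏ c : {c // c ∈ D}, w c (e.symm (u, v) c)) *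
        ∏ c : {c // c ∉ D}, w c (e.symm (u, v) c) := by
      convert (Fintype.prod_subtype_mul_prod_subtype (fun c => c ∈ D) _).symm
    rw [h2, hgG, Finset.prod_subtype D (fun _ => Iff.rfl), Finset.prod_mul_distrib]
    simp only [hin, hout]
    ring
  rw [← e.symm.sum_comp, Fintype.sum_prod_type_right]
  simp only [h1, ← Finset.mul_sum]
  refine sum_mul_le_of_mem_stdSimplex
    (p := fun v : {c // c ∉ D} → α => ∏ c : {c // c ∉ D}, w c (v c)) ⟨?_, ?_⟩ ?_
  · exact fun v => Finset.prod_nonneg fun c _ => (hw c).1 _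
  · exact sum_prod_eq_one fun c : {c // c ∉ D} => hw c
  · intro v
    rw [sum_prod_univ fun (c : {c // c ∈ D}) a => w c a * G v a]
    refine (Finset.prod_le_prod (g := fun _ => B) (fun c _ => Finset.sum_nonneg fun a _ =>
      mul_nonneg ((hw c.1).1 a) (hg0 _ a)) fun c _ => hB _ c.1 c.2).trans_eq ?_
    rw [Finset.prod_const, Finset.card_univ, Fintype.card_of_subtype D fun _ => Iff.rfl]

/-- Hoeffding's lemma for a finitely supported distribution. -/
theorem sum_mul_exp_le_of_mem_Icc {α : Type*} [Fintype α] {p : α → ℝ}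
    (hp : p ∈ stdSimplex ℝ α) {f : α → ℝ} {b : ℝ} (hf : ∀ a, f a ∈ Set.Icc 0 b) (l : ℝ) :
    ∑ a, p a * Real.exp (l * (f a - ∑ a, p a * f a)) ≤ Real.exp (b ^ 2 * l ^ 2 / 8) := by
  let : MeasurableSpace α := ⊤
  set μ : Measure α := ∑ a, ENNReal.ofReal (p a) • Measure.dirac a with hμ
  have hμ1 : IsProbabilityMeasure μ := ⟨by
    simp only [hμ, Measure.coe_finsetSum, Finset.sum_apply, Measure.smul_apply, measure_univ,
      smul_eq_mul, mul_one]
    rw [← ENNReal.ofReal_sum_of_nonneg fun a _ => hp.1 a, hp.2, ENNReal.ofReal_one]⟩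
  have hint : ∀ g : α → ℝ, ∫ a, g a ∂μ = ∑ a, p a * g a := by
    intro g
    rw [hμ, integral_finsetSum_measure fun a _ =>
      (integrable_dirac (by simp)).smul_measure ENNReal.ofReal_ne_top]
    refine Finset.sum_congr rfl fun a _ => ?_
    rw [integral_smul_measure, integral_dirac, ENNReal.toReal_ofReal (hp.1 a), smul_eq_mul]
  have h := (hasSubgaussianMGF_of_mem_Icc (μ := μ) (X := f) (a := 0) (b := b)
    measurable_from_top.aemeasurable (Eventually.of_forall hf)).mgf_le l
  rw [mgf, hint, hint] at h
  refine h.trans_eq ?_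
  congr 1
  simp only [NNReal.coe_pow, NNReal.coe_div, coe_nnnorm, sub_zero, Real.norm_eq_abs, div_pow,
    sq_abs, NNReal.coe_ofNat]
  ring

/-- The averaged function may be random, provided that it depends only on coordinates outside the
sample. Conditionally on those, the exponential factorizes and Hoeffding's lemma applies with
parameter l/n to each of the n factors. -/
theorem sum_mul_exp_average_le {C α : Type*} [Fintype C] [Fintype α] [Nonempty α] [DecidableEq C]
    {w : C → α → ℝ} (hw : ∀ c, w c ∈ stdSimplex ℝ α) {n : ℕ} (hn : 0 < n) (ι : Fin n ↪ C)
    {p : α → ℝ} (hp : ∀ j, w (ι j) = p) {f : (C → α) → α → ℝ}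
    (hf : ∀ y y', (∀ c ∉ Set.range ι, y c = y' c) → f y = f y') {b : ℝ}
    (hfb : ∀ y a, f y a ∈ Set.Icc 0 b) (l : ℝ) :
    ∑ y : C → α, (∏ c, w c (y c)) *
      Real.exp (l * ((1 / (n : ℝ)) * ∑ j, f y (y (ι j)) - ∑ a, p a * f y a)) ≤
      Real.exp (b ^ 2 * l ^ 2 / (8 * n)) := by
  have hn' : (n : ℝ) ≠ 0 := by exact_mod_cast hn.ne'
  have hpw : p ∈ stdSimplex ℝ α := hp ⟨0, hn⟩ ▸ hw _
  have h1 := sum_prod_mul_prod_le hw (Finset.univ.map ι)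
    (g := fun y a => Real.exp (l / n * (f y a - ∑ a, p a * f y a)))
    (B := Real.exp (b ^ 2 * (l / n) ^ 2 / 8)) (fun y y' hyy => by
      have : f y = f y' := hf y y' fun c hc => hyy c (by simpa using hc)
      simp only [this]) (fun y a => (Real.exp_pos _).le) (fun y c hc => by
      obtain ⟨j, -, rfl⟩ := Finset.mem_map.1 hc
      rw [hp]
      exact sum_mul_exp_le_of_mem_Icc hpw (hfb y) _)
  rw [Finset.card_map, Finset.card_univ, Fintype.card_fin, ← Real.exp_nat_mul] at h1
  refine le_trans (le_of_eq (Finset.sum_congr rfl fun y _ => ?_)) (h1.trans_eq ?_)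
  · rw [Finset.prod_map, ← Real.exp_sum, ← Finset.mul_sum, Finset.sum_sub_distrib,
      Finset.sum_const, Finset.card_univ, Fintype.card_fin, nsmul_eq_mul]
    congr 2
    field_simp
  · congr 1
    field_simp

/-- A union bound at the level of exponential moments: the maximum is one of the terms, with one of
the two signs. -/
theorem exp_mul_iSup_abs_le {ι : Type*} [Fintype ι] [Nonempty ι] (z : ι → ℝ) (l : ℝ) :
    Real.exp (l * ⨆ i, |z i|) ≤ ∑ i, (Real.exp (l * z i) + Real.exp (-l * z i)) := by
  obtain ⟨i, hi⟩ := exists_eq_ciSup_of_finite (f := fun i => |z i|)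
  rw [← hi]
  refine le_trans ?_ (Finset.single_le_sum (f := fun i => Real.exp (l * z i) +
    Real.exp (-l * z i)) (fun i _ => by positivity) (Finset.mem_univ i))
  rcases abs_cases (z i) with ⟨h, _⟩ | ⟨h, _⟩
  · simp only [h]
    linarith [Real.exp_pos (-l * z i)]
  · simp only [h, mul_neg, neg_mul]
    linarith [Real.exp_pos (l * z i)]

end FiniteProducts

/-! ### Exponential moments of the errors of one iteration. -/

section SampleLaw

variable {S : Type u} {A : Type v} [Fintype S] [Fintype A] {h M M₀ H : ℕ} (m : MDP S A)

theorem MDP.sampleProb_nonneg {π : S → A → ℝ} (hπ : IsPolicy π) (x : Samples S A h M M₀ H) :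
    0 ≤ m.sampleProb π x :=
  mul_nonneg (Finset.prod_nonneg fun _ _ => (m.P_mem _ _).1 _)
    (Finset.prod_nonneg fun _ _ => Finset.prod_nonneg fun _ _ => m.trajProb_nonneg hπ _ _)

/-- The value vector backed up at a level depends only on rollouts and lower levels. The draws of
that level are therefore fresh, although the tree is shared. -/
theorem MDP.vHat_congr {x x' : Samples S A h M M₀ H} (k : ℕ) (hk : k < h)
    (h1 : ∀ c : TreeCall S A h M, (c.1 : ℕ) < k → x.1 c = x'.1 c) (h2 : x.2 = x'.2) :
    m.vHat x k hk = m.vHat x' k hk := by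
  induction k with
  | zero =>
    have h3 : ∀ s j, rollout x s j = rollout x' s j := fun s j => by
      funext t
      exact congrFun h2 _
    funext s
    simp only [MDP.vHat, MDP.rolloutValue, h3]
  | succ k ih =>
    have ih' := ih (Nat.lt_of_succ_lt hk) fun c hc => h1 c (Nat.lt_succ_of_lt hc)
    funext s
    simp only [MDP.vHat, MDP.backup]
    rw [ih']
    simp only [h1 (⟨k, _⟩, _, _, _) (Nat.lt_succ_self k)]

/-- Rollouts, regrouped as one trajectory for each starting state and repetition. -/
def rolloutEquiv (S : Type u) (A : Type v) (M₀ H : ℕ) :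
    (RolloutCall S M₀ H → A × S) ≃ (S × Fin M₀ → Fin H → A × S) :=
  ((Equiv.prodAssoc S (Fin M₀) (Fin H)).symm.arrowCongr (Equiv.refl (A × S))).trans
    (Equiv.curry (S × Fin M₀) (Fin H) (A × S))

theorem MDP.trajProb_mem_stdSimplex {π : S → A → ℝ}
    (hπ : IsPolicy π) (s : S) :
    (fun τ : Fin H → A × S => m.trajProb π s τ) ∈ stdSimplex ℝ (Fin H → A × S) :=
  ⟨fun τ => m.trajProb_nonneg hπ s τ, m.sum_trajProb hπ H s⟩

variable [DecidableEq S] [DecidableEq A]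

theorem MDP.sum_sampleProb_mul (π : S → A → ℝ)
    (f : Samples S A h M M₀ H → ℝ) :
    ∑ x, m.sampleProb π x * f x =
      ∑ y : TreeCall S A h M → S, ∑ z : S × Fin M₀ → Fin H → A × S,
        (∏ c, m.P c.2.1 c.2.2.1 (y c)) * (∏ c, m.trajProb π c.1 (z c)) *
          f (y, (rolloutEquiv S A M₀ H).symm z) := by
  rw [Fintype.sum_prod_type]
  refine Finset.sum_congr rfl fun y _ => ?_
  rw [← (rolloutEquiv S A M₀ H).symm.sum_comp]
  refine Finset.sum_congr rfl fun z _ => ?_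
  rw [MDP.sampleProb, Fintype.prod_prod_type (f := fun c : S × Fin M₀ => m.trajProb π c.1 (z c))]
  rfl

variable [Nonempty S] [Nonempty A]

theorem MDP.sum_sampleProb_exp_nodeErr_le {π : S → A → ℝ} (hπ : IsPolicy π) (hM : 0 < M)
    (k : Fin h) (y : S × A) (l : ℝ) :
    ∑ x : Samples S A h M M₀ H, m.sampleProb π x * Real.exp (l * m.nodeErr x k y) ≤
      Real.exp ((1 / (1 - m.γ)) ^ 2 * l ^ 2 / (8 * M)) := by
  have h1 := m.sum_sampleProb_mul (h := h) (M := M) (M₀ := M₀) (H := H) π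
    (fun x => Real.exp (l * m.nodeErr x k y))
  refine (h1.trans Finset.sum_comm).trans_le ?_
  -- The bound is uniform in the rollouts `z`, which are then averaged out.
  have h2 : ∀ z : S × Fin M₀ → Fin H → A × S,
      ∑ x : TreeCall S A h M → S, (∏ c, m.P c.2.1 c.2.2.1 (x c)) *
        Real.exp (l * m.nodeErr (x, (rolloutEquiv S A M₀ H).symm z) k y) ≤
      Real.exp ((1 / (1 - m.γ)) ^ 2 * l ^ 2 / (8 * M)) := fun z =>
    sum_mul_exp_average_le (w := fun c : TreeCall S A h M => m.P c.2.1 c.2.2.1)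
      (fun c => m.P_mem _ _) hM
      ⟨fun j => (k, y.1, y.2, j), fun i j hij => by simpa using hij⟩ (p := m.P y.1 y.2)
      (fun _ => rfl)
      (f := fun x s => m.vHat (x, (rolloutEquiv S A M₀ H).symm z) k k.2 s)
      (fun x x' hx => m.vHat_congr k k.2 (fun c hc => hx c (by
        rintro ⟨j, rfl⟩
        exact lt_irrefl _ hc)) rfl)
      (fun x s => m.vHat_mem _ k k.2 s) l
  have hp : (fun z : S × Fin M₀ → Fin H → A × S => ∏ c, m.trajProb π c.1 (z c)) ∈
      stdSimplex ℝ (S × Fin M₀ → Fin H → A × S) := by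
    refine ⟨fun z => Finset.prod_nonneg fun c _ => m.trajProb_nonneg hπ _ _, ?_⟩
    exact sum_prod_eq_one (w := fun (c : S × Fin M₀) τ => m.trajProb π c.1 τ)
        fun c => m.trajProb_mem_stdSimplex hπ c.1
  have h3 := sum_mul_le_of_mem_stdSimplex hp h2
  refine le_trans (le_of_eq (Finset.sum_congr rfl fun z _ => ?_)) h3
  rw [Finset.mul_sum]
  exact Finset.sum_congr rfl fun x _ => by ring

theorem MDP.sum_sampleProb_exp_rolloutValue_le {π : S → A → ℝ} (hπ : IsPolicy π) (hM : 0 < M₀)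
    (s : S) (l : ℝ) :
    ∑ x : Samples S A h M M₀ H,
      m.sampleProb π x * Real.exp (l * (m.rolloutValue x s - m.expRet π H s)) ≤
      Real.exp ((1 / (1 - m.γ)) ^ 2 * l ^ 2 / (8 * M₀)) := by
  have h1 := m.sum_sampleProb_mul (h := h) (M := M) (M₀ := M₀) (H := H) π
    (fun x => Real.exp (l * (m.rolloutValue x s - m.expRet π H s)))
  refine h1.trans_le ?_
  have h2 : ∀ x : TreeCall S A h M → S,
      ∑ z : S × Fin M₀ → Fin H → A × S, (∏ c, m.trajProb π c.1 (z c)) *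
        Real.exp (l * (m.rolloutValue (h := h) (M := M) (x, (rolloutEquiv S A M₀ H).symm z) s -
          m.expRet π H s)) ≤
      Real.exp ((1 / (1 - m.γ)) ^ 2 * l ^ 2 / (8 * M₀)) := fun x =>
    sum_mul_exp_average_le (w := fun c : S × Fin M₀ => fun τ => m.trajProb π c.1 τ)
      (fun c => m.trajProb_mem_stdSimplex hπ c.1) hM
      ⟨fun j => (s, j), fun i j hij => by simpa using hij⟩
      (fun _ => rfl) (f := fun _ τ => m.ret s τ) (fun _ _ _ => rfl) (fun _ τ => m.ret_mem s τ) l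
  have h3 := sum_mul_le_of_mem_stdSimplex
    (p := fun x : TreeCall S A h M → S => ∏ c, m.P c.2.1 c.2.2.1 (x c))
    ⟨fun x => Finset.prod_nonneg fun c _ => (m.P_mem _ _).1 _,
      sum_prod_eq_one (w := fun c : TreeCall S A h M => m.P c.2.1 c.2.2.1)
        fun c => m.P_mem c.2.1 c.2.2.1⟩ h2
  refine le_trans (le_of_eq (Finset.sum_congr rfl fun x _ => ?_)) h3
  rw [Finset.mul_sum]
  exact Finset.sum_congr rfl fun z _ => by ring

theorem MDP.sum_sampleProb_exp_treeErr_le {π : S → A → ℝ} (hπ : IsPolicy π) (hM : 0 < M)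
    (k : Fin h) (l : ℝ) :
    ∑ x : Samples S A h M M₀ H, m.sampleProb π x * Real.exp (l * m.treeErr x k) ≤
      2 * Fintype.card (S × A) * Real.exp ((1 / (1 - m.γ)) ^ 2 * l ^ 2 / (8 * M)) := by
  calc _ ≤ ∑ x : Samples S A h M M₀ H, m.sampleProb π x *
        ∑ y, (Real.exp (l * m.nodeErr x k y) + Real.exp (-l * m.nodeErr x k y)) :=
        Finset.sum_le_sum fun x _ => mul_le_mul_of_nonneg_left (exp_mul_iSup_abs_le _ l)
          (m.sampleProb_nonneg hπ x)
    _ = ∑ y, (∑ x : Samples S A h M M₀ H, m.sampleProb π x * Real.exp (l * m.nodeErr x k y) +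
          ∑ x : Samples S A h M M₀ H, m.sampleProb π x * Real.exp (-l * m.nodeErr x k y)) := by
        simp only [Finset.mul_sum, ← Finset.sum_add_distrib, ← mul_add]
        exact Finset.sum_comm
    _ ≤ ∑ y : S × A, 2 * Real.exp ((1 / (1 - m.γ)) ^ 2 * l ^ 2 / (8 * M)) := by
        refine Finset.sum_le_sum fun y _ => ?_
        have h1 := m.sum_sampleProb_exp_nodeErr_le (M₀ := M₀) (H := H) hπ hM k y l
        have h2 := m.sum_sampleProb_exp_nodeErr_le (M₀ := M₀) (H := H) hπ hM k y (-l)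
        rw [neg_sq] at h2
        linarith
    _ = _ := by
        rw [Finset.sum_const, Finset.card_univ, nsmul_eq_mul]
        ring

theorem MDP.sum_sampleProb_exp_rollErr_le {π : S → A → ℝ} (hπ : IsPolicy π) (hM : 0 < M₀)
    (l : ℝ) :
    ∑ x : Samples S A h M M₀ H, m.sampleProb π x * Real.exp (l * m.rollErr π x) ≤
      2 * Fintype.card S * Real.exp ((1 / (1 - m.γ)) ^ 2 * l ^ 2 / (8 * M₀)) := by
  calc _ ≤ ∑ x : Samples S A h M M₀ H, m.sampleProb π x *
        ∑ s, (Real.exp (l * (m.rolloutValue x s - m.expRet π H s)) +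
          Real.exp (-l * (m.rolloutValue x s - m.expRet π H s))) :=
        Finset.sum_le_sum fun x _ => mul_le_mul_of_nonneg_left (exp_mul_iSup_abs_le _ l)
          (m.sampleProb_nonneg hπ x)
    _ = ∑ s, (∑ x : Samples S A h M M₀ H, m.sampleProb π x *
            Real.exp (l * (m.rolloutValue x s - m.expRet π H s)) +
          ∑ x : Samples S A h M M₀ H, m.sampleProb π x *
            Real.exp (-l * (m.rolloutValue x s - m.expRet π H s))) := by
        simp only [Finset.mul_sum, ← Finset.sum_add_distrib, ← mul_add]
        exact Finset.sum_comm
    _ ≤ ∑ s : S, 2 * Real.exp ((1 / (1 - m.γ)) ^ 2 * l ^ 2 / (8 * M₀)) := by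
        refine Finset.sum_le_sum fun s _ => ?_
        have h1 := m.sum_sampleProb_exp_rolloutValue_le (h := h) (M := M) (H := H) hπ hM s l
        have h2 := m.sum_sampleProb_exp_rolloutValue_le (h := h) (M := M) (H := H) hπ hM s (-l)
        rw [neg_sq] at h2
        linarith
    _ = _ := by
        rw [Finset.sum_const, Finset.card_univ, nsmul_eq_mul]
        ring

end SampleLaw

end HPMD

namespace HPMD

/-! ### A Chernoff bound for dependent weighted sums. -/

section Chernoff

/-- Chernoff's bound for a weighted average of (possibly dependent) variables with a common bound
on their exponential moments. -/
theorem measure_lt_sum_mul_le {Ω ι : Type*} {mΩ : MeasurableSpace Ω} {μ : Measure Ω}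
    [Fintype ι] {w : ι → ℝ} (hw : ∀ i, 0 ≤ w i) (hW : 0 < ∑ i, w i) {Z : ι → Ω → ℝ}
    (hZ : ∀ i, Measurable (Z i)) {l B t : ℝ} (hl : 0 ≤ l)
    (hB : ∀ i, ∫⁻ ω, ENNReal.ofReal (Real.exp (l * Z i ω)) ∂μ ≤ ENNReal.ofReal B) :
    μ {ω | t * ∑ i, w i < ∑ i, w i * Z i ω} ≤ ENNReal.ofReal (Real.exp (-(l * t)) * B) := by
  set W := ∑ i, w i with hW_def
  have hsub : {ω | t * W < ∑ i, w i * Z i ω} ⊆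
      {ω | ENNReal.ofReal (W * Real.exp (l * t)) ≤
        ∑ i, ENNReal.ofReal (w i) * ENNReal.ofReal (Real.exp (l * Z i ω))} := by
    intro ω hω
    rw [Set.mem_ofPred_eq] at hω ⊢
    simp only [← ENNReal.ofReal_mul (hw _)]
    rw [← ENNReal.ofReal_sum_of_nonneg fun i _ => mul_nonneg (hw i) (Real.exp_pos _).le]
    refine ENNReal.ofReal_le_ofReal ?_
    -- The tangent line of exp at l t plays the role of Jensen's inequality; summed over i, its
    -- correction is nonnegative on the event. Markov's inequality for the weighted sum of
    -- exponentials then concludes.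
    have h1 : ∀ i, w i * (Real.exp (l * t) * (1 + l * (Z i ω - t))) ≤
        w i * Real.exp (l * Z i ω) := fun i => by
      refine mul_le_mul_of_nonneg_left ?_ (hw i)
      rw [show l * Z i ω = l * t + l * (Z i ω - t) by ring, Real.exp_add]
      exact mul_le_mul_of_nonneg_left (by linarith [Real.add_one_le_exp (l * (Z i ω - t))])
        (Real.exp_pos _).le
    refine le_trans ?_ (Finset.sum_le_sum fun i _ => h1 i)
    have h2 : ∑ i, w i * (Real.exp (l * t) * (1 + l * (Z i ω - t))) =
        Real.exp (l * t) * (W + l * (∑ i, w i * Z i ω - t * W)) := by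
      rw [hW_def, Finset.mul_sum, ← Finset.sum_sub_distrib, Finset.mul_sum,
        ← Finset.sum_add_distrib, Finset.mul_sum]
      exact Finset.sum_congr rfl fun i _ => by ring
    rw [h2, mul_comm]
    exact mul_le_mul_of_nonneg_left (by nlinarith) (Real.exp_pos _).le
  have hpos : 0 < W * Real.exp (l * t) := mul_pos hW (Real.exp_pos _)
  have hmeas : ∀ i, Measurable fun ω =>
      ENNReal.ofReal (w i) * ENNReal.ofReal (Real.exp (l * Z i ω)) := fun i =>
    ((((hZ i).const_mul l).exp).ennreal_ofReal).const_mul _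
  have hint : ∫⁻ ω, ∑ i, ENNReal.ofReal (w i) * ENNReal.ofReal (Real.exp (l * Z i ω)) ∂μ ≤
      ENNReal.ofReal W * ENNReal.ofReal B := by
    rw [lintegral_finsetSum _ fun i _ => hmeas i, hW_def,
      ENNReal.ofReal_sum_of_nonneg fun i _ => hw i, Finset.sum_mul]
    refine Finset.sum_le_sum fun i _ => ?_
    rw [lintegral_const_mul' _ _ ENNReal.ofReal_ne_top]
    gcongr
    exact hB i
  refine (measure_mono hsub).trans ((meas_ge_le_lintegral_div
    (Finset.measurable_sum _ fun i _ => hmeas i).aemeasurable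
    (ENNReal.ofReal_pos.2 hpos).ne' ENNReal.ofReal_ne_top).trans
    ((ENNReal.div_le_div_right hint _).trans_eq ?_))
  rw [← ENNReal.ofReal_mul hW.le, ← ENNReal.ofReal_div_of_pos hpos, Real.exp_neg]
  congr 1
  have := (Real.exp_pos (l * t)).ne'
  field_simp

end Chernoff

/-! ### Conditional laws and the recursion along a run. -/

section RunLaw

variable {S : Type u} {A : Type v} [Fintype S] [Fintype A] {h M M₀ H : ℕ} {m : MDP S A}

theorem MDP.measurable_trajProb (m : MDP S A) {n : ℕ} (s : S) (τ : Fin n → A × S) :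
    Measurable fun π : S → A → ℝ => m.trajProb π s τ := by
  unfold MDP.trajProb
  fun_prop

theorem MDP.measurable_expRet (m : MDP S A) (n : ℕ) (s : S) :
    Measurable fun π : S → A → ℝ => m.expRet π n s :=
  Finset.measurable_sum _ fun τ _ => (m.measurable_trajProb s τ).mul_const _

theorem MDP.measurable_sampleProb (m : MDP S A) (x : Samples S A h M M₀ H) :
    Measurable fun π : S → A → ℝ => m.sampleProb π x :=
  measurable_const.mul (Finset.measurable_prod _ fun s _ =>
    Finset.measurable_prod _ fun _ _ => m.measurable_trajProb s _)

theorem MDP.measurable_rollErr (m : MDP S A) (x : Samples S A h M M₀ H) :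
    Measurable fun π : S → A → ℝ => m.rollErr π x :=
  Measurable.iSup fun s => ((m.measurable_expRet H s).const_sub _).abs

variable {Ω : Type w} {mΩ : MeasurableSpace Ω} {K : ℕ} {φ : (A → ℝ) → ℝ} {hh : 0 < h}
  {π₀ : S → A → ℝ} {μ : Measure Ω} {ℱ : Filtration ℕ mΩ}
  {X : Fin K → Ω → Samples S A h M M₀ H} {η : Fin K → Ω → ℝ} {π : ℕ → Ω → S → A → ℝ}

theorem IsRun.ae_isPolicy (hrun : IsRun m φ hh π₀ μ ℱ X η π) (hπ₀ : IsPolicy π₀) :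
    ∀ᵐ ω ∂μ, ∀ k ≤ K, IsPolicy (π k ω) := by
  filter_upwards [hrun.init, hrun.policy_mem] with ω h0 h1 k hk
  cases k with
  | zero => rwa [h0]
  | succ k => exact h1 ⟨k, hk⟩

theorem IsRun.measurableSet_sample (hrun : IsRun m φ hh π₀ μ ℱ X η π) (k : Fin K)
    (x : Samples S A h M M₀ H) : MeasurableSet (X k ⁻¹' {x}) :=
  ℱ.le _ _ (hrun.sample_measurable k x)

/-- `sample_law` says that two measures agree on the past; trimming both to `ℱ k` extends this from
events to integrands measurable for the past. -/
theorem IsRun.setLIntegral_sample (hrun : IsRun m φ hh π₀ μ ℱ X η π) (k : Fin K)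
    (x : Samples S A h M M₀ H) {g : Ω → ENNReal} (hg : Measurable[ℱ k] g) :
    ∫⁻ ω in X k ⁻¹' {x}, g ω ∂μ =
      ∫⁻ ω, ENNReal.ofReal (m.sampleProb (π k ω) x) * g ω ∂μ := by
  have hπ : Measurable (π k) := (hrun.policy_measurable k k.2.le).mono (ℱ.le k) le_rfl
  have hd : Measurable fun ω => ENNReal.ofReal (m.sampleProb (π k ω) x) :=
    ((m.measurable_sampleProb x).comp hπ).ennreal_ofReal
  have htrim : (μ.restrict (X k ⁻¹' {x})).trim (ℱ.le k) =
      (μ.withDensity fun ω => ENNReal.ofReal (m.sampleProb (π k ω) x)).trim (ℱ.le k) := by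
    refine @Measure.ext _ (ℱ k) _ _ fun E hE => ?_
    rw [trim_measurableSet_eq _ hE, trim_measurableSet_eq _ hE,
      Measure.restrict_apply (ℱ.le k _ hE), withDensity_apply _ (ℱ.le k _ hE)]
    exact hrun.sample_law k x E hE
  rw [← lintegral_trim (ℱ.le k) hg, htrim, lintegral_trim (ℱ.le k) hg,
    lintegral_withDensity_eq_lintegral_mul _ hd (hg.mono (ℱ.le k) le_rfl)]
  rfl

theorem IsRun.measurable_comp_sample (hrun : IsRun m φ hh π₀ μ ℱ X η π) (k : Fin K)
    {f : (S → A → ℝ) → Samples S A h M M₀ H → ℝ} (hf : ∀ x, Measurable fun p => f p x) :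
    Measurable fun ω => f (π k ω) (X k ω) := by
  have hπ : Measurable (π k) := (hrun.policy_measurable k k.2.le).mono (ℱ.le k) le_rfl
  intro E hE
  have : (fun ω => f (π k ω) (X k ω)) ⁻¹' E =
      ⋃ x, (X k ⁻¹' {x}) ∩ ((fun ω => f (π k ω) x) ⁻¹' E) := by
    ext ω
    simp
  rw [this]
  exact MeasurableSet.iUnion fun x =>
    (hrun.measurableSet_sample k x).inter (((hf x).comp hπ) hE)

/-- Tower property: split over the finitely many sample values and use the conditional law. A bound
valid for every fixed policy then carries over to the random iterate. -/
theorem IsRun.lintegral_comp_sample_le [DecidableEq S] [DecidableEq A]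
    (hrun : IsRun m φ hh π₀ μ ℱ X η π) [IsProbabilityMeasure μ]
    (hπ₀ : IsPolicy π₀) (k : Fin K)
    {f : (S → A → ℝ) → Samples S A h M M₀ H → ℝ} (hf : ∀ x, Measurable fun p => f p x)
    (hf0 : ∀ p x, 0 ≤ f p x) {B : ℝ}
    (hB : ∀ p, IsPolicy p → ∑ x, m.sampleProb p x * f p x ≤ B) :
    ∫⁻ ω, ENNReal.ofReal (f (π k ω) (X k ω)) ∂μ ≤ ENNReal.ofReal B := by
  have hπ := hrun.policy_measurable k k.2.le
  have hg : ∀ x, Measurable[ℱ k] fun ω => ENNReal.ofReal (f (π k ω) x) := fun x =>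
    ((hf x).comp hπ).ennreal_ofReal
  have hg' : ∀ x, Measurable fun ω => ENNReal.ofReal (f (π k ω) x) := fun x =>
    (hg x).mono (ℱ.le k) le_rfl
  have hd : ∀ x : Samples S A h M M₀ H,
      Measurable fun ω => ENNReal.ofReal (m.sampleProb (π k ω) x) := fun x =>
    ((m.measurable_sampleProb x).comp (hπ.mono (ℱ.le k) le_rfl)).ennreal_ofReal
  have h1 : ∀ ω, ENNReal.ofReal (f (π k ω) (X k ω)) =
      ∑ x, (X k ⁻¹' {x}).indicator (fun ω => ENNReal.ofReal (f (π k ω) x)) ω := by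
    intro ω
    rw [Finset.sum_eq_single (X k ω)]
    · simp
    · intro x _ hx
      exact Set.indicator_of_notMem (fun h => hx h.symm) _
    · simp
  simp only [h1]
  rw [lintegral_finsetSum _ fun x _ => (hg' x).indicator (hrun.measurableSet_sample k x)]
  have h2 : ∀ x, ∫⁻ ω, (X k ⁻¹' {x}).indicator (fun ω => ENNReal.ofReal (f (π k ω) x)) ω ∂μ =
      ∫⁻ ω, ENNReal.ofReal (m.sampleProb (π k ω) x) * ENNReal.ofReal (f (π k ω) x) ∂μ := fun x => by
    rw [lintegral_indicator (hrun.measurableSet_sample k x), hrun.setLIntegral_sample k x (hg x)]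
  simp only [h2]
  have hm : ∀ x, Measurable fun ω =>
      ENNReal.ofReal (m.sampleProb (π k ω) x) * ENNReal.ofReal (f (π k ω) x) := fun x =>
    (hd x).mul (hg' x)
  rw [← lintegral_finsetSum _ fun x _ => hm x]
  calc _ ≤ ∫⁻ _ω, ENNReal.ofReal B ∂μ := by
        refine lintegral_mono_ae ?_
        filter_upwards [hrun.ae_isPolicy hπ₀] with ω hω
        have hp := hω k k.2.le
        simp only [← ENNReal.ofReal_mul (m.sampleProb_nonneg hp _)]
        rw [← ENNReal.ofReal_sum_of_nonneg fun x _ =>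
          mul_nonneg (m.sampleProb_nonneg hp x) (hf0 _ x)]
        exact ENNReal.ofReal_le_ofReal (hB _ hp)
    _ = _ := by simp

theorem IsRun.ae_norm_Vstar_sub_le [Nonempty A] {dom : Set (A → ℝ)}
    (hrun : IsRun m φ hh π₀ μ ℱ X η π) (hφ : IsMirrorMap φ dom) (hπ₀ : IsPolicy π₀)
    (hpos : ∀ s a, 0 < π₀ s a) :
    ∀ᵐ ω ∂μ, ∀ k, ∀ hk : k ≤ K, ‖m.Vstar - m.V (π k ω)‖ ≤
      m.γ ^ (h * k) * (‖m.Vstar - m.V π₀‖ + (1 - m.γ ^ (h * k)) / ((1 - m.γ) * (1 - m.γ ^ h))) +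
      2 / (1 - m.γ) * ∑ i : Fin k, (m.γ ^ h) ^ (k - 1 - i : ℕ) *
        m.estErr (π i ω) (X (Fin.castLE hk i) ω) := by
  filter_upwards [hrun.init, hrun.ae_isPolicy hπ₀, hrun.stepsize_pos, hrun.stepsize, hrun.update]
    with ω h0 hpol hη hstep hupd k hk
  -- Positivity puts the initial policy in the interior; steepness does it for every update.
  have hint : ∀ i ≤ K, ∀ s, π i ω s ∈ interior dom := by
    intro i hi s
    cases i with
    | zero => rw [h0]; exact hφ.relint_subset _ (hπ₀ s) (hpos s)
    | succ i => exact hφ.update_mem_interior (hpol _ hi) (hupd ⟨i, hi⟩) s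
  set e : ℕ → ℝ := fun i => if hi : i < K then m.estErr (π i ω) (X ⟨i, hi⟩ ω) else 0 with he
  have h1 := unroll_recursion (g := m.γ ^ h) (γ := m.γ) (pow_nonneg m.γ_pos.le h)
    (pow_lt_one₀ m.γ_pos.le m.γ_lt_one hh.ne') m.γ_lt_one
    (a := fun i => ‖m.Vstar - m.V (π i ω)‖) (e := e) (K := K) (fun i hi => by
      have h2 := m.norm_Vstar_sub_update_le hφ hh (hpol i hi.le) (hint i hi.le) (hpol (i + 1) hi)
        (X ⟨i, hi⟩ ω) (hη ⟨i, hi⟩) (pow_pos m.γ_pos _) (hstep ⟨i, hi⟩) (hupd ⟨i, hi⟩)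
      simp only [he, hi, dif_pos]
      rw [← pow_mul, show h * (2 * (i + 1)) = 2 * h * (i + 1) by ring]
      exact h2) k hk
  rw [← pow_mul, h0, ← Fin.sum_univ_eq_sum_range (fun i => (m.γ ^ h) ^ (k - 1 - i) * e i)] at h1
  refine h1.trans_eq ?_
  congr 2
  refine Finset.sum_congr rfl fun i _ => ?_
  have : (i : ℕ) < K := i.2.trans_le hk
  simp only [he, this, dif_pos]
  rfl

end RunLaw

end HPMD

namespace HPMD

/-! ### High-probability bounds for the iterates. -/

section Confidence

theorem IsRun.ae_zero {S : Type u} {A : Type v} [Fintype S] [Fintype A] {h M M₀ H : ℕ}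
    {m : MDP S A} {Ω : Type w} {mΩ : MeasurableSpace Ω} {K : ℕ} {φ : (A → ℝ) → ℝ} {hh : 0 < h}
    {π₀ : S → A → ℝ} {μ : Measure Ω} {ℱ : Filtration ℕ mΩ}
    {X : Fin K → Ω → Samples S A h M M₀ H} {η : Fin K → Ω → ℝ} {π : ℕ → Ω → S → A → ℝ}
    (hrun : IsRun m φ hh π₀ μ ℱ X η π) {ε : ℝ} (hε : 0 ≤ ε) :
    ∀ᵐ ω ∂μ, ‖m.Vstar - m.V (π 0 ω)‖ ≤ m.subopt h ε π₀ 0 := by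
  filter_upwards [hrun.init] with ω h0
  simp [h0, MDP.subopt, hε]

theorem sum_fin_pow_rev_le {g : ℝ} (hg0 : 0 ≤ g) (hg1 : g < 1) (k : ℕ) :
    ∑ i : Fin k, g ^ (k - 1 - i : ℕ) ≤ 1 / (1 - g) := by
  rw [Fin.sum_univ_eq_sum_range (fun i => g ^ (k - 1 - i)), Finset.sum_range_reflect (fun i => g ^ i),
    one_div, ← tsum_geometric_of_lt_one hg0 hg1]
  exact (summable_geometric_of_lt_one hg0 hg1).sum_le_tsum _ fun i _ => pow_nonneg hg0 i

theorem sum_fin_pow_sub_le {γ : ℝ} (hγ0 : 0 ≤ γ) (hγ1 : γ < 1) (h : ℕ) :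
    ∑ j : Fin h, γ ^ (h - j : ℕ) ≤ (1 - γ ^ h) / (1 - γ) := by
  -- A factor γ is given away here.
  have h1 : ∑ j : Fin h, γ ^ (h - j : ℕ) ≤ ∑ j : Fin h, γ ^ (h - 1 - j : ℕ) :=
    Finset.sum_le_sum fun j _ => pow_le_pow_of_le_one hγ0 hγ1.le (by omega)
  refine h1.trans_eq ?_
  rw [Fin.sum_univ_eq_sum_range (fun i => γ ^ (h - 1 - i)),
    Finset.sum_range_reflect (fun i => γ ^ i), geom_sum_eq hγ1.ne, ← neg_div_neg_eq, neg_sub,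
    neg_sub]

variable {S : Type u} {A : Type v} [Fintype S] [Fintype A] {h M M₀ H : ℕ} {m : MDP S A}

theorem MDP.pow_lt_one (m : MDP S A) (hh : 0 < h) : m.γ ^ h < 1 :=
  pow_lt_one₀ m.γ_pos.le m.γ_lt_one hh.ne'

/-- The truncation error of the rollouts. -/
theorem MDP.pow_mul_pow_div_le (m : MDP S A) (hh : 0 < h) {ε : ℝ} (hε : 0 < ε)
    (hH : m.lengthBound h ε < H) :
    m.γ ^ h * (m.γ ^ H / (1 - m.γ)) ≤ ε * (1 - m.γ) * (1 - m.γ ^ h) / 12 := by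
  have h1 := m.one_sub_pos
  have h2 := sub_pos.2 (m.pow_lt_one hh)
  have h3 := pow_pos m.γ_pos h
  have h4 := pow_pos m.γ_pos H
  set D := ε * (1 - m.γ) * (1 - m.γ ^ h) / 4 * (1 - m.γ) with hD
  have hDpos : 0 < D := by positivity
  have h5 : Real.log (3 * m.γ ^ h / D) < H * (1 - m.γ) := by
    rw [MDP.lengthBound, one_div, inv_mul_lt_iff₀ h1] at hH
    linarith
  have h6 : Real.log (3 * m.γ ^ h / D) < -(H * Real.log m.γ) := by
    have := Real.log_le_sub_one_of_pos m.γ_pos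
    nlinarith [Nat.cast_nonneg (α := ℝ) H]
  have h7 : Real.log (3 * m.γ ^ h / D * m.γ ^ H) < 0 := by
    rw [Real.log_mul (by positivity) (by positivity), Real.log_pow]
    linarith
  have h8 : 3 * m.γ ^ h / D * m.γ ^ H < 1 := (Real.log_neg_iff (by positivity)).1 h7
  rw [div_mul_eq_mul_div, div_lt_one hDpos] at h8
  rw [← mul_div_assoc, div_le_iff₀ h1]
  linarith

theorem MDP.pow_mul_lt (m : MDP S A) (hh : 0 < h) {K : ℕ} {ε : ℝ} (hε : 0 < ε)
    (hK : m.iterBound h ε < K) : m.γ ^ (h * K) < ε * (1 - m.γ) * (1 - m.γ ^ h) / 4 := by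
  have h1 := m.one_sub_pos
  have h2 := sub_pos.2 (m.pow_lt_one hh)
  have h3 := pow_pos m.γ_pos (h * K)
  have h4 : (0 : ℝ) < h := by exact_mod_cast hh
  have h5 : Real.log (4 / (ε * (1 - m.γ) * (1 - m.γ ^ h))) < K * (h * (1 - m.γ)) := by
    rw [MDP.iterBound, one_div, inv_mul_lt_iff₀ (by positivity)] at hK
    linarith
  have h6 : Real.log (4 / (ε * (1 - m.γ) * (1 - m.γ ^ h)) * m.γ ^ (h * K)) < 0 := by
    rw [Real.log_mul (by positivity) (by positivity), Real.log_pow]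
    have h7 := mul_le_mul_of_nonneg_left (Real.log_le_sub_one_of_pos m.γ_pos)
      (Nat.cast_nonneg (α := ℝ) (h * K))
    push_cast at h7 ⊢
    linarith
  have h8 := (Real.log_neg_iff (by positivity)).1 h6
  rw [div_mul_eq_mul_div, div_lt_one (by positivity)] at h8
  linarith

variable [Nonempty S] [Nonempty A]

theorem one_le_cast_card (α : Type*) [Fintype α] [Nonempty α] : (1 : ℝ) ≤ Fintype.card α := by
  exact_mod_cast Fintype.card_pos

theorem two_mul_exp_le {c L u δ : ℝ} (hL : Real.log u ≤ L) (hu : 0 < u) (hc : 0 ≤ c)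
    (h : 4 * c ≤ δ * u) : 2 * c * Real.exp (-L) ≤ δ / 2 := by
  have h1 : Real.exp (-L) ≤ u⁻¹ := by
    rw [← Real.exp_log (inv_pos.2 hu), Real.log_inv]
    exact Real.exp_le_exp.2 (neg_le_neg hL)
  calc 2 * c * Real.exp (-L) ≤ 2 * c * u⁻¹ := mul_le_mul_of_nonneg_left h1 (by positivity)
    _ ≤ δ / 2 := by
      rw [← div_eq_mul_inv, div_le_iff₀ hu]
      linarith

theorem treeBound_log_pos {h : ℕ} (hh : 0 < h) {δ : ℝ} (hδ : 0 < δ) (hδ1 : δ < 1) :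
    0 < Real.log (4 * h * Fintype.card A * Fintype.card S * Fintype.card (S × A) / δ) := by
  have h1 := one_le_cast_card S
  have h2 := one_le_cast_card A
  have h3 := one_le_cast_card (S × A)
  have h4 : (1 : ℝ) ≤ h := by exact_mod_cast hh
  refine Real.log_pos ((one_lt_div hδ).2 (hδ1.trans_le ?_))
  have := one_le_mul_of_one_le_of_one_le (one_le_mul_of_one_le_of_one_le
    (one_le_mul_of_one_le_of_one_le h4 h2) h1) h3
  linarith

theorem rolloutBound_log_pos {δ : ℝ} (hδ : 0 < δ) (hδ1 : δ < 1) :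
    0 < Real.log (4 * Fintype.card S * Fintype.card (S × A) / δ) := by
  have h1 := one_le_cast_card S
  have h3 := one_le_cast_card (S × A)
  refine Real.log_pos ((one_lt_div hδ).2 (hδ1.trans_le ?_))
  have := one_le_mul_of_one_le_of_one_le h1 h3
  linarith

theorem MDP.treeBound_pos (m : MDP S A) (hh : 0 < h) {ε δ : ℝ} (hε : 0 < ε) (hδ : 0 < δ)
    (hδ1 : δ < 1) : 0 < m.treeBound h ε δ :=
  have := m.one_sub_pos
  mul_pos (by positivity) (treeBound_log_pos hh hδ hδ1)

theorem MDP.rolloutBound_pos (m : MDP S A) (hh : 0 < h) {ε δ : ℝ} (hε : 0 < ε) (hδ : 0 < δ)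
    (hδ1 : δ < 1) : 0 < m.rolloutBound h ε δ :=
  have := m.one_sub_pos
  have := sub_pos.2 (m.pow_lt_one hh)
  have := m.γ_pos
  mul_pos (by positivity) (rolloutBound_log_pos hδ hδ1)

variable {Ω : Type w} {mΩ : MeasurableSpace Ω} {K : ℕ} {φ : (A → ℝ) → ℝ} {hh : 0 < h}
  {π₀ : S → A → ℝ} {μ : Measure Ω} [IsProbabilityMeasure μ] {ℱ : Filtration ℕ mΩ}
  {X : Fin K → Ω → Samples S A h M M₀ H} {η : Fin K → Ω → ℝ} {π : ℕ → Ω → S → A → ℝ}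

theorem IsRun.measure_treeErr_le (hrun : IsRun m φ hh π₀ μ ℱ X η π) (hπ₀ : IsPolicy π₀)
    {ε δ : ℝ} (hε : 0 < ε) (hδ : 0 < δ) (hδ1 : δ < 1) (htree : m.treeBound h ε δ < M)
    {k : ℕ} (hk0 : 0 < k) (hk : k ≤ K) :
    μ {ω | ε * (1 - m.γ) / 12 < ∑ i : Fin k, (m.γ ^ h) ^ (k - 1 - i : ℕ) *
      ∑ j : Fin h, m.γ ^ (h - j : ℕ) * m.treeErr (X (Fin.castLE hk i) ω) j} ≤
      ENNReal.ofReal (δ / 2) := by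
  classical
  have h1 := m.one_sub_pos
  have hγ := m.γ_pos
  have hM : (0 : ℝ) < M := (m.treeBound_pos hh hε hδ hδ1).trans htree
  have hM' : 0 < M := by exact_mod_cast hM
  -- Chosen so that t times 1/(1-γ), the bound on the total weight, is ε(1-γ)/12. The next line
  -- takes the minimizer l of b² l²/(8M) - l t for the range b = 1/(1-γ).
  set t := ε * (1 - m.γ) ^ 2 / 12 with ht
  set l := 4 * t * M * (1 - m.γ) ^ 2 with hl
  set w : Fin k × Fin h → ℝ := fun i => (m.γ ^ h) ^ (k - 1 - i.1 : ℕ) * m.γ ^ (h - i.2 : ℕ) with hw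
  have hWpos : 0 < ∑ i, w i :=
    have : Nonempty (Fin k × Fin h) := ⟨⟨0, hk0⟩, ⟨0, hh⟩⟩
    Finset.sum_pos (fun i _ => by positivity) Finset.univ_nonempty
  have hW : ∑ i, w i ≤ 1 / (1 - m.γ) := by
    have h2 := sub_pos.2 (m.pow_lt_one hh)
    rw [Fintype.sum_prod_type]
    simp only [hw]
    rw [← Finset.sum_mul_sum]
    -- The factor 1 - γ^h from the levels cancels the 1/(1-γ^h) from the iterations, so the
    -- requirement on `M` is free of 1 - γ^h.
    refine (mul_le_mul (sum_fin_pow_rev_le (pow_nonneg hγ.le h) (m.pow_lt_one hh) k)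
      (sum_fin_pow_sub_le hγ.le m.γ_lt_one h) (Finset.sum_nonneg fun j _ => by positivity)
      (by positivity)).trans_eq ?_
    field_simp
  have hmain := measure_lt_sum_mul_le (μ := μ) (w := w) (fun i => by positivity) hWpos
    (Z := fun i ω => m.treeErr (X (Fin.castLE hk i.1) ω) i.2)
    (fun i => hrun.measurable_comp_sample (Fin.castLE hk i.1) (f := fun _ x => m.treeErr x i.2)
      fun _ => measurable_const)
    (l := l) (t := t) (B := 2 * Fintype.card (S × A) *
      Real.exp ((1 / (1 - m.γ)) ^ 2 * l ^ 2 / (8 * M))) (by positivity)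
    (fun i => hrun.lintegral_comp_sample_le hπ₀ (Fin.castLE hk i.1)
      (f := fun _ x => Real.exp (l * m.treeErr x i.2)) (fun _ => measurable_const)
      (fun _ _ => (Real.exp_pos _).le)
      fun p hp => m.sum_sampleProb_exp_treeErr_le hp hM' i.2 l)
  refine (measure_mono ?_).trans (hmain.trans (ENNReal.ofReal_le_ofReal ?_))
  · intro ω hω
    rw [Set.mem_ofPred_eq] at hω ⊢
    have h3 : ∑ i, w i * m.treeErr (X (Fin.castLE hk i.1) ω) i.2 =
        ∑ i : Fin k, (m.γ ^ h) ^ (k - 1 - i : ℕ) *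
          ∑ j : Fin h, m.γ ^ (h - j : ℕ) * m.treeErr (X (Fin.castLE hk i) ω) j := by
      rw [Fintype.sum_prod_type]
      simp only [hw, Finset.mul_sum, mul_assoc]
    rw [h3]
    refine lt_of_le_of_lt ?_ hω
    refine (mul_le_mul_of_nonneg_left hW (by positivity)).trans_eq ?_
    rw [ht]
    field_simp
  · rw [mul_comm, mul_assoc, ← Real.exp_add]
    have h3 : (1 / (1 - m.γ)) ^ 2 * l ^ 2 / (8 * M) + -(l * t) =
        -(M * ((1 - m.γ) ^ 6 * ε ^ 2) / 72) := by
      rw [hl, ht]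
      field_simp
      ring
    rw [h3]
    have hL := treeBound_log_pos (S := S) (A := A) hh hδ hδ1
    have h4 : (1 : ℝ) ≤ h := by exact_mod_cast hh
    have h5 := one_le_cast_card S
    have h6 := one_le_cast_card A
    have h7 := one_le_cast_card (S × A)
    refine two_mul_exp_le (u := 4 * h * Fintype.card A * Fintype.card S * Fintype.card (S × A) / δ)
      ?_ (by positivity) (by positivity) ?_
    -- The exponent needs the constant 72 only; 144 gives twice the logarithm, which is positive by
    -- `hL`.
    · rw [MDP.treeBound, div_mul_eq_mul_div, div_lt_iff₀ (by positivity)] at htree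
      linarith
    · rw [mul_div_cancel₀ _ hδ.ne']
      have := one_le_mul_of_one_le_of_one_le (one_le_mul_of_one_le_of_one_le h4 h6) h5
      nlinarith

theorem IsRun.measure_rollErr_le (hrun : IsRun m φ hh π₀ μ ℱ X η π) (hπ₀ : IsPolicy π₀)
    {ε δ : ℝ} (hε : 0 < ε) (hδ : 0 < δ) (hδ1 : δ < 1) (hroll : m.rolloutBound h ε δ ≤ M₀)
    {k : ℕ} (hk0 : 0 < k) (hk : k ≤ K) :
    μ {ω | ε * (1 - m.γ) / 12 < ∑ i : Fin k, (m.γ ^ h) ^ (k - 1 - i : ℕ) *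
      (m.γ ^ h * m.rollErr (π i ω) (X (Fin.castLE hk i) ω))} ≤ ENNReal.ofReal (δ / 2) := by
  classical
  have h1 := m.one_sub_pos
  have hγ := m.γ_pos
  have h2 := sub_pos.2 (m.pow_lt_one hh)
  have hM : (0 : ℝ) < M₀ := (m.rolloutBound_pos hh hε hδ hδ1).trans_le hroll
  have hM' : 0 < M₀ := by exact_mod_cast hM
  set g := m.γ ^ h with hg
  have hgpos : 0 < g := by positivity
  -- The total weight is at most g/(1-g), again leaving ε(1-γ)/12. The g in the denominator is the
  -- source of γ^(2h) in the rollout threshold.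
  set t := ε * (1 - m.γ) * (1 - g) / (12 * g) with ht
  set l := 4 * t * M₀ * (1 - m.γ) ^ 2 with hl
  set w : Fin k → ℝ := fun i => g ^ (k - 1 - i : ℕ) * g with hw
  have hWpos : 0 < ∑ i, w i :=
    have : Nonempty (Fin k) := ⟨⟨0, hk0⟩⟩
    Finset.sum_pos (fun i _ => by positivity) Finset.univ_nonempty
  have hW : ∑ i, w i ≤ 1 / (1 - g) * g := by
    simp only [hw]
    rw [← Finset.sum_mul]
    exact mul_le_mul_of_nonneg_right (sum_fin_pow_rev_le hgpos.le (m.pow_lt_one hh) k) hgpos.le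
  have hmain := measure_lt_sum_mul_le (μ := μ) (w := w) (fun i => by positivity) hWpos
    (Z := fun i ω => m.rollErr (π i ω) (X (Fin.castLE hk i) ω))
    (fun i => hrun.measurable_comp_sample (Fin.castLE hk i) (f := fun p x => m.rollErr p x)
      fun x => m.measurable_rollErr x)
    (l := l) (t := t) (B := 2 * Fintype.card S *
      Real.exp ((1 / (1 - m.γ)) ^ 2 * l ^ 2 / (8 * M₀))) (by positivity)
    (fun i => hrun.lintegral_comp_sample_le hπ₀ (Fin.castLE hk i)
      (f := fun p x => Real.exp (l * m.rollErr p x))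
      (fun x => ((m.measurable_rollErr x).const_mul l).exp)
      (fun _ _ => (Real.exp_pos _).le)
      fun p hp => m.sum_sampleProb_exp_rollErr_le hp hM' l)
  refine (measure_mono ?_).trans (hmain.trans (ENNReal.ofReal_le_ofReal ?_))
  · intro ω hω
    rw [Set.mem_ofPred_eq] at hω ⊢
    simp only [← mul_assoc] at hω
    refine lt_of_le_of_lt ?_ hω
    refine (mul_le_mul_of_nonneg_left hW (by positivity)).trans_eq ?_
    rw [ht]
    field_simp
  · rw [mul_comm, mul_assoc, ← Real.exp_add]
    have h3 : (1 / (1 - m.γ)) ^ 2 * l ^ 2 / (8 * M₀) + -(l * t) =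
        -(M₀ * ((1 - m.γ) ^ 4 * (1 - g) ^ 2 * ε ^ 2) / (72 * g ^ 2)) := by
      rw [hl, ht]
      field_simp
      ring
    rw [h3]
    have hL := rolloutBound_log_pos (S := S) (A := A) hδ hδ1
    have h5 := one_le_cast_card S
    have h7 := one_le_cast_card (S × A)
    refine two_mul_exp_le (u := 4 * Fintype.card S * Fintype.card (S × A) / δ)
      ?_ (by positivity) (by positivity) ?_
    · rw [MDP.rolloutBound, div_mul_eq_mul_div, div_le_iff₀ (by positivity), mul_comm 2 h,
        pow_mul, ← hg] at hroll
      rw [le_div_iff₀ (by positivity)]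
      nlinarith [mul_pos (pow_pos hgpos 2) hL]
    · rw [mul_div_cancel₀ _ hδ.ne']
      nlinarith

/-- A single iterate meets the convergence bound with high probability. -/
theorem IsRun.measure_not_le_le {dom : Set (A → ℝ)}
    (hrun : IsRun m φ hh π₀ μ ℱ X η π) (hφ : IsMirrorMap φ dom) (hπ₀ : IsPolicy π₀)
    (hpos : ∀ s a, 0 < π₀ s a) {ε δ : ℝ} (hε : 0 < ε) (hδ : 0 < δ) (hδ1 : δ < 1)
    (htree : m.treeBound h ε δ < M) (hroll : m.rolloutBound h ε δ ≤ M₀)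
    (hlen : m.lengthBound h ε < H) {k : ℕ} (hk0 : 0 < k) (hk : k ≤ K) :
    μ {ω | ¬ ‖m.Vstar - m.V (π k ω)‖ ≤ m.γ ^ (h * k) * (‖m.Vstar - m.V π₀‖ +
      (1 - m.γ ^ (h * k)) / ((1 - m.γ) * (1 - m.γ ^ h))) + ε / 2} ≤ ENNReal.ofReal δ := by
  have h1 := m.one_sub_pos
  have h2 := sub_pos.2 (m.pow_lt_one hh)
  have hsplit : ENNReal.ofReal δ = ENNReal.ofReal (δ / 2) + ENNReal.ofReal (δ / 2) := by
    rw [← ENNReal.ofReal_add (by positivity) (by positivity), add_halves]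
  rw [hsplit]
  refine le_trans ?_ ((measure_union_le _ _).trans (add_le_add
    (hrun.measure_treeErr_le hπ₀ hε hδ hδ1 htree hk0 hk)
    (hrun.measure_rollErr_le hπ₀ hε hδ hδ1 hroll hk0 hk)))
  refine measure_mono_ae ?_
  filter_upwards [hrun.ae_norm_Vstar_sub_le hφ hπ₀ hpos] with ω hω
  intro hbad
  by_contra hgood
  refine hbad ((hω k hk).trans (add_le_add_right ?_ _))
  have hgood' := not_or.1 hgood
  rw [Set.mem_ofPred_eq, not_lt, Set.mem_ofPred_eq, not_lt] at hgood'
  obtain ⟨htree', hroll'⟩ := hgood'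
  have hbias : ∑ i : Fin k, (m.γ ^ h) ^ (k - 1 - i : ℕ) * (m.γ ^ h * (m.γ ^ H / (1 - m.γ))) ≤
      ε * (1 - m.γ) / 12 := by
    rw [← Finset.sum_mul]
    have h3 := m.γ_pos
    refine (mul_le_mul (sum_fin_pow_rev_le (pow_nonneg m.γ_pos.le h) (m.pow_lt_one hh) k)
      (m.pow_mul_pow_div_le hh hε hlen) (by positivity) (by positivity)).trans_eq ?_
    field_simp
  -- Tree, rollout and truncation errors contribute ε(1-γ)/12 each; the prefactor 2/(1-γ) turns
  -- their sum into ε/2.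
  have hsum : ∑ i : Fin k, (m.γ ^ h) ^ (k - 1 - i : ℕ) *
      m.estErr (π i ω) (X (Fin.castLE hk i) ω) ≤ ε * (1 - m.γ) / 4 := by
    have : ∀ i : Fin k, (m.γ ^ h) ^ (k - 1 - i : ℕ) *
        m.estErr (π i ω) (X (Fin.castLE hk i) ω) =
        (m.γ ^ h) ^ (k - 1 - i : ℕ) *
          ∑ j : Fin h, m.γ ^ (h - j : ℕ) * m.treeErr (X (Fin.castLE hk i) ω) j +
        (m.γ ^ h) ^ (k - 1 - i : ℕ) * (m.γ ^ h * m.rollErr (π i ω) (X (Fin.castLE hk i) ω)) +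
        (m.γ ^ h) ^ (k - 1 - i : ℕ) * (m.γ ^ h * (m.γ ^ H / (1 - m.γ))) := fun i => by
      rw [MDP.estErr]
      ring
    simp only [this, Finset.sum_add_distrib]
    linarith
  refine (mul_le_mul_of_nonneg_left hsum (by positivity)).trans_eq ?_
  field_simp
  ring

theorem ofReal_one_sub_le_measure {Ω : Type*} {mΩ : MeasurableSpace Ω} {μ : Measure Ω}
    [IsProbabilityMeasure μ] {s : Set Ω} {δ : ℝ} (hδ : 0 ≤ δ) (h : μ sᶜ ≤ ENNReal.ofReal δ) :
    ENNReal.ofReal (1 - δ) ≤ μ s := by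
  rw [ENNReal.ofReal_sub _ hδ, ENNReal.ofReal_one, tsub_le_iff_right]
  calc (1 : ENNReal) = μ (s ∪ sᶜ) := by rw [Set.union_compl_self, measure_univ]
    _ ≤ μ s + μ sᶜ := measure_union_le _ _
    _ ≤ μ s + ENNReal.ofReal δ := by gcongr

theorem IsRun.confidence_each {dom : Set (A → ℝ)}
    (hrun : IsRun m φ hh π₀ μ ℱ X η π) (hφ : IsMirrorMap φ dom) (hπ₀ : IsPolicy π₀)
    (hpos : ∀ s a, 0 < π₀ s a) {ε δ : ℝ} (hε : 0 < ε) (hδ : 0 < δ) (hδ1 : δ < 1)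
    (hadm : Admissible m h ε δ K M M₀ H) {k : ℕ} (hk : k ≤ K) :
    ENNReal.ofReal (1 - δ) ≤ μ {ω | ‖m.Vstar - m.V (π k ω)‖ ≤ m.subopt h ε π₀ k} := by
  refine ofReal_one_sub_le_measure hδ.le ?_
  rcases Nat.eq_zero_or_pos k with rfl | hk0
  · have := ae_iff.1 (hrun.ae_zero hε.le)
    exact (le_of_eq this).trans zero_le
  · refine (measure_mono ?_).trans (hrun.measure_not_le_le hφ hπ₀ hpos hε hδ hδ1
      hadm.tree hadm.rollout hadm.length hk0 hk)
    intro ω hω hle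
    exact hω (hle.trans (by rw [MDP.subopt]; linarith))

theorem IsRun.confidence_all {dom : Set (A → ℝ)}
    (hrun : IsRun m φ hh π₀ μ ℱ X η π) (hφ : IsMirrorMap φ dom) (hπ₀ : IsPolicy π₀)
    (hpos : ∀ s a, 0 < π₀ s a) {ε δ : ℝ} (hε : 0 < ε) (hδ : 0 < δ) (hδ1 : δ < 1)
    (hadm : Admissible m h ε (δ / K) K M M₀ H) :
    ENNReal.ofReal (1 - δ) ≤
      μ {ω | (∀ k ≤ K, ‖m.Vstar - m.V (π k ω)‖ ≤ m.subopt h ε π₀ k) ∧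
        ‖m.Vstar - m.V (π K ω)‖ ≤ ε} := by
  have h1 := m.one_sub_pos
  have h2 := sub_pos.2 (m.pow_lt_one hh)
  have hγK := pow_pos m.γ_pos (h * K)
  -- The half of ε not spent on sampling errors pays for the bias at the last iterate.
  have hlast : m.γ ^ (h * K) * (‖m.Vstar - m.V π₀‖ +
      (1 - m.γ ^ (h * K)) / ((1 - m.γ) * (1 - m.γ ^ h))) ≤ ε / 2 := by
    have h3 := m.norm_Vstar_sub_le_one_div hπ₀
    have h4 : ‖m.Vstar - m.V π₀‖ + (1 - m.γ ^ (h * K)) / ((1 - m.γ) * (1 - m.γ ^ h)) ≤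
        2 / ((1 - m.γ) * (1 - m.γ ^ h)) := by
      have h5 : 1 / (1 - m.γ) ≤ 1 / ((1 - m.γ) * (1 - m.γ ^ h)) :=
        one_div_le_one_div_of_le (by positivity)
          (mul_le_of_le_one_right h1.le (by linarith [pow_pos m.γ_pos h]))
      have h6 : (1 - m.γ ^ (h * K)) / ((1 - m.γ) * (1 - m.γ ^ h)) ≤
          1 / ((1 - m.γ) * (1 - m.γ ^ h)) := by
        gcongr
        linarith
      have h7 : 2 / ((1 - m.γ) * (1 - m.γ ^ h)) = 1 / ((1 - m.γ) * (1 - m.γ ^ h)) +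
        1 / ((1 - m.γ) * (1 - m.γ ^ h)) := by ring
      linarith
    refine (mul_le_mul (m.pow_mul_lt hh hε hadm.iter).le h4 (add_nonneg (norm_nonneg _)
      (div_nonneg (sub_nonneg.2 (pow_le_one₀ m.γ_pos.le m.γ_lt_one.le)) (by positivity)))
      (by positivity)).trans_eq ?_
    field_simp
    ring
  refine ofReal_one_sub_le_measure hδ.le ?_
  set bad : ℕ → Set Ω := fun k => {ω | ¬ ‖m.Vstar - m.V (π k ω)‖ ≤ m.γ ^ (h * k) *
    (‖m.Vstar - m.V π₀‖ + (1 - m.γ ^ (h * k)) / ((1 - m.γ) * (1 - m.γ ^ h))) + ε / 2} with hbad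
  -- Iterate 0 satisfies its bound almost surely, so only K events share δ.
  have hbad_le : ∀ i : Fin K, μ (bad (i + 1)) ≤ ENNReal.ofReal (δ / K) := fun i => by
    have hK0 : 0 < K := i.pos
    have hK : (1 : ℝ) ≤ K := by exact_mod_cast hK0
    exact hrun.measure_not_le_le hφ hπ₀ hpos hε (div_pos hδ (by linarith))
      ((div_le_self hδ.le hK).trans_lt hδ1) hadm.tree hadm.rollout hadm.length i.succ_pos i.2
  have hunion : μ (⋃ i : Fin K, bad (i + 1)) ≤ ENNReal.ofReal δ := by
    refine (measure_iUnion_fintype_le _ _).trans ((Finset.sum_le_sum fun i _ => hbad_le i).trans ?_)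
    rw [Finset.sum_const, Finset.card_univ, Fintype.card_fin, nsmul_eq_mul,
      ← ENNReal.ofReal_natCast, ← ENNReal.ofReal_mul (Nat.cast_nonneg K)]
    refine ENNReal.ofReal_le_ofReal ?_
    rcases Nat.eq_zero_or_pos K with hK | hK
    · simp [hK, hδ.le]
    · exact (mul_div_cancel₀ δ (Nat.cast_ne_zero.2 hK.ne')).le
  refine (measure_mono_ae ?_).trans hunion
  filter_upwards [hrun.init, hrun.ae_zero hε.le] with ω h0 hz
  intro hω
  by_contra hgood
  have hgood' : ∀ k, 0 < k → k ≤ K → ω ∉ bad k := fun k hk0 hk hb =>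
    hgood (Set.mem_iUnion.2 ⟨⟨k - 1, by omega⟩, by
      rwa [show ((⟨k - 1, by omega⟩ : Fin K) : ℕ) + 1 = k from Nat.sub_add_cancel hk0]⟩)
  refine hω ⟨fun k hk => ?_, ?_⟩
  · rcases Nat.eq_zero_or_pos k with rfl | hk0
    · exact hz
    · exact (not_not.1 (hgood' k hk0 hk)).trans (by rw [MDP.subopt]; linarith)
  · rcases Nat.eq_zero_or_pos K with hK0 | hK0
    -- Without iterations, `hlast` itself bounds the initial error.
    · have h3 : ‖m.Vstar - m.V (π K ω)‖ = ‖m.Vstar - m.V π₀‖ := by rw [hK0, h0]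
      rw [h3]
      simp only [hK0, mul_zero, pow_zero, sub_self, zero_div, add_zero, one_mul] at hlast
      linarith
    · have := not_not.1 (hgood' K hK0 le_rfl)
      linarith

end Confidence

end HPMD

namespace HPMD

/-! ### Counting samples. -/

section Complexity

theorem isLeast_natCast_le_add_one {p : ℕ → Prop} {n : ℕ} {x : ℝ} (hn : IsLeast {k | p k} n)
    (hx : 0 ≤ x) (hp : ∀ k : ℕ, 1 ≤ k → x < k → p k) : (n : ℝ) ≤ x + 1 := by
  have h1 : n ≤ ⌊x⌋₊ + 1 := hn.2 (hp _ (Nat.le_add_left _ _) (by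
    push_cast
    exact Nat.lt_floor_add_one x))
  have h2 : (n : ℝ) ≤ ⌊x⌋₊ + 1 := by exact_mod_cast h1
  linarith [Nat.floor_le hx]

theorem totalSamples_eq (S : Type u) (A : Type v) [Fintype S] [Fintype A] (K h M M₀ H : ℕ) :
    totalSamples S A K h M M₀ H =
      K * M₀ * H * Fintype.card S + K * h * M * Fintype.card S * Fintype.card A := by
  simp only [totalSamples, Fintype.card_prod, Fintype.card_sum, Fintype.card_fin]
  ring

theorem div_add_one_le_div {a b c : ℝ} (hb : 0 < b) (hbc : b ≤ c) : a / b + 1 ≤ (a + c) / b := by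
  rw [add_div]
  linarith [(one_le_div hb).2 hbc]

variable {S : Type u} {A : Type v} [Fintype S] [Fintype A] [Nonempty S] [Nonempty A]
  {h K M M₀ H : ℕ} {m : MDP S A}

theorem MDP.totalSamples_le (m : MDP S A) (hh : 0 < h) {ε δ : ℝ} (hε : 0 < ε) (hδ : 0 < δ)
    (hδ1 : δ < 1) (hT : 1 ≤ m.iterBound h ε)
    (hleast : LeastAdmissible m h ε δ K M M₀ H ∨ LeastAdmissible m h ε (δ / K) K M M₀ H) :
    (totalSamples S A K h M M₀ H : ℝ) ≤
      104832 * (Fintype.card S / (h * ε ^ 2 * (1 - m.γ) ^ 6 * (1 - m.γ ^ h) ^ 2) +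
        Fintype.card S * Fintype.card A / (ε ^ 2 * (1 - m.γ) ^ 7)) *
      (1 + Real.log (Fintype.card S * Fintype.card A * h * (1 + 1 / ε) /
        (δ * (1 - m.γ)))) ^ 3 := by
  have hγ := m.γ_pos
  have hs := one_le_cast_card S
  have ha := one_le_cast_card A
  have hh1 : (1 : ℝ) ≤ h := by exact_mod_cast hh
  -- Both confidence levels are treated at once; the price is a log K, bounded by `hlogK`.
  obtain ⟨δ', hδ'0, hδ'1, hδ'K, hl⟩ : ∃ δ', 0 < δ' ∧ δ' < 1 ∧ 1 / δ' ≤ K / δ ∧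
      LeastAdmissible m h ε δ' K M M₀ H := by
    have hK : ∀ δ'', LeastAdmissible m h ε δ'' K M M₀ H → (1 : ℝ) ≤ K := fun δ'' hl =>
      hT.trans hl.iter.1.le
    rcases hleast with hl | hl
    · exact ⟨δ, hδ, hδ1, by gcongr; exact hK δ hl, hl⟩
    · have hK1 := hK _ hl
      exact ⟨δ / K, by positivity, (div_le_self hδ.le hK1).trans_lt hδ1, by rw [one_div_div], hl⟩
  have hu := m.one_sub_pos
  have hv := sub_pos.2 (m.pow_lt_one hh)
  have hg1 := (m.pow_lt_one hh).le
  have hg0 := pow_pos hγ h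
  have huv : 1 - m.γ ≤ 1 - m.γ ^ h := by
    linarith [pow_le_of_le_one hγ.le m.γ_lt_one.le hh.ne']
  have hu1 : 1 - m.γ ≤ 1 := by linarith
  have hv1 : 1 - m.γ ^ h ≤ 1 := by linarith
  have hg2 : m.γ ^ (2 * h) ≤ 1 := pow_le_one₀ hγ.le m.γ_lt_one.le
  have hrollL := rolloutBound_log_pos (S := S) (A := A) hδ'0 hδ'1
  have hcard : (Fintype.card (S × A) : ℝ) = Fintype.card S * Fintype.card A := by
    rw [Fintype.card_prod]; push_cast; rfl
  have hKle := isLeast_natCast_le_add_one hl.iter (by linarith) fun k _ hk => hk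
  have hMle := isLeast_natCast_le_add_one hl.tree (m.treeBound_pos hh hε hδ'0 hδ'1).le
    fun k _ hk => hk
  have hM₀le := isLeast_natCast_le_add_one hl.rollout (m.rolloutBound_pos hh hε hδ'0 hδ'1).le
    fun k _ hk => hk.le
  -- The length threshold may be negative, hence the maximum with 0.
  have hHle := isLeast_natCast_le_add_one hl.length (le_max_right (m.lengthBound h ε) 0)
    fun k hk1 hk => ⟨hk1, (le_max_left _ _).trans_lt hk⟩
  have hK1 : (1 : ℝ) ≤ K := hT.trans hl.iter.1.le
  unfold MDP.iterBound at hT hKle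
  unfold MDP.treeBound at hMle
  unfold MDP.rolloutBound at hM₀le
  unfold MDP.lengthBound at hHle
  rw [hcard] at hMle hM₀le hrollL
  rw [totalSamples_eq]
  push_cast
  set s : ℝ := (Fintype.card S : ℝ)
  set a : ℝ := (Fintype.card A : ℝ)
  set u : ℝ := 1 - m.γ
  set v : ℝ := 1 - m.γ ^ h
  have hlog4 : Real.log 4 ≤ 3 := by linarith [Real.log_le_sub_one_of_pos (by norm_num : (0:ℝ) < 4)]
  have hlog6 : Real.log 6 ≤ 5 := by linarith [Real.log_le_sub_one_of_pos (by norm_num : (0:ℝ) < 6)]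
  have hlog12 : Real.log 12 ≤ 11 := by
    linarith [Real.log_le_sub_one_of_pos (by norm_num : (0:ℝ) < 12)]
  have hε1 : 0 < 1 / ε := by positivity
  have hlogs := Real.log_nonneg hs
  have hloga := Real.log_nonneg ha
  have hlogh := Real.log_nonneg hh1
  have hlogε : 0 ≤ Real.log (1 + 1 / ε) := Real.log_nonneg (by linarith)
  have hlogδ : 0 ≤ -Real.log δ := neg_nonneg.2 (Real.log_nonpos hδ.le hδ1.le)
  have hlogu : 0 ≤ -Real.log u := neg_nonneg.2 (Real.log_nonpos hu.le hu1)
  have hloguv : Real.log u ≤ Real.log v := Real.log_le_log hu huv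
  have hX : Real.log (s * a * h * (1 + 1 / ε) / (δ * u)) =
      Real.log s + Real.log a + Real.log h + Real.log (1 + 1 / ε) - Real.log δ - Real.log u := by
    rw [Real.log_div (by positivity) (by positivity), Real.log_mul (by positivity) (by positivity),
      Real.log_mul (by positivity) (by positivity), Real.log_mul (by positivity) (by positivity),
      Real.log_mul (by positivity) (by positivity)]
    ring
  rw [hX]
  set Y := 1 + (Real.log s + Real.log a + Real.log h + Real.log (1 + 1 / ε) - Real.log δ -
    Real.log u) with hY
  have hY1 : 1 ≤ Y := by linarith
  have hnlogε : -Real.log ε ≤ Real.log (1 + 1 / ε) := by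
    rw [← Real.log_inv, ← one_div]
    exact Real.log_le_log hε1 (by linarith)
  have hLK : Real.log (4 / (ε * u * v)) ≤ 3 * Y := by
    rw [Real.log_div (by positivity) (by positivity), Real.log_mul (by positivity) (by positivity),
      Real.log_mul (by positivity) (by positivity)]
    linarith
  -- T ≥ 1 rules out large ε, which would make the target smaller than the + 1 from rounding up.
  have hεuv : ε * u * v ≤ 4 := by
    by_contra! hlt
    have h1 : Real.log (4 / (ε * u * v)) ≤ 0 :=
      Real.log_nonpos (by positivity) ((div_le_one (by positivity)).2 hlt.le)
    have h2 := mul_nonpos_of_nonneg_of_nonpos (by positivity : 0 ≤ 1 / (h * u)) h1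
    linarith
  -- Here T ≥ 1 is used as K ≤ T + 1 ≤ 2T.
  have hKle' : (K : ℝ) ≤ 6 * Y / (h * u) := by
    calc (K : ℝ) ≤ 2 * (1 / (h * u) * Real.log (4 / (ε * u * v))) := by linarith
      _ ≤ 2 * (1 / (h * u) * (3 * Y)) := by gcongr
      _ = _ := by ring
  have hlogK : Real.log K ≤ 7 * Y := by
    have h1 := Real.log_le_log (by positivity) hKle'
    rw [Real.log_div (by positivity) (by positivity), Real.log_mul (by positivity) (by positivity),
      Real.log_mul (by positivity) (by positivity)] at h1
    linarith [Real.log_le_sub_one_of_pos (by linarith : 0 < Y)]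
  have hlogδ' : -Real.log δ' ≤ Real.log K - Real.log δ := by
    have h1 := Real.log_le_log (by positivity) hδ'K
    rwa [Real.log_div (by positivity) (by positivity), Real.log_div (by positivity) (by positivity),
      Real.log_one, zero_sub] at h1
  have hΛ1 : Real.log (4 * h * a * s * (s * a) / δ') ≤ 10 * Y := by
    rw [Real.log_div (by positivity) (by positivity), Real.log_mul (by positivity) (by positivity),
      Real.log_mul (by positivity) (by positivity), Real.log_mul (by positivity) (by positivity),
      Real.log_mul (by positivity) (by positivity), Real.log_mul (by positivity) (by positivity)]
    linarith
  have hΛ2 : Real.log (4 * s * (s * a) / δ') ≤ 10 * Y := by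
    rw [Real.log_div (by positivity) (by positivity), Real.log_mul (by positivity) (by positivity),
      Real.log_mul (by positivity) (by positivity), Real.log_mul (by positivity) (by positivity)]
    linarith
  have hsq : ε ^ 2 * u ^ 2 * v ^ 2 ≤ 16 := by
    have := pow_le_pow_left₀ (by positivity) hεuv 2
    linarith [mul_pow (ε * u) v 2, mul_pow ε u 2]
  have hMle' : (M : ℝ) ≤ 1456 * Y / (u ^ 6 * ε ^ 2) := by
    have h1 : u ^ 6 * ε ^ 2 ≤ 16 * Y := by
      calc u ^ 6 * ε ^ 2 = ε ^ 2 * u ^ 2 * u ^ 2 * u ^ 2 := by ring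
        _ ≤ ε ^ 2 * u ^ 2 * v ^ 2 * 1 := by gcongr; exact pow_le_one₀ hu.le hu1
        _ ≤ 16 * Y := by linarith
    calc (M : ℝ) ≤ 144 / (u ^ 6 * ε ^ 2) * (10 * Y) + 1 := hMle.trans (by gcongr)
      _ = 1440 * Y / (u ^ 6 * ε ^ 2) + 1 := by ring
      _ ≤ (1440 * Y + 16 * Y) / (u ^ 6 * ε ^ 2) := div_add_one_le_div (by positivity) h1
      _ = _ := by ring
  have hM₀le' : (M₀ : ℝ) ≤ 1456 * Y / (u ^ 4 * v ^ 2 * ε ^ 2) := by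
    have h1 : u ^ 4 * v ^ 2 * ε ^ 2 ≤ 16 * Y := by
      calc u ^ 4 * v ^ 2 * ε ^ 2 = ε ^ 2 * u ^ 2 * v ^ 2 * u ^ 2 := by ring
        _ ≤ ε ^ 2 * u ^ 2 * v ^ 2 * 1 := by gcongr; exact pow_le_one₀ hu.le hu1
        _ ≤ 16 * Y := by linarith
    calc (M₀ : ℝ) ≤ 144 * 1 / (u ^ 4 * v ^ 2 * ε ^ 2) * (10 * Y) + 1 :=
          hM₀le.trans (by gcongr)
      _ = 1440 * Y / (u ^ 4 * v ^ 2 * ε ^ 2) + 1 := by ring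
      _ ≤ (1440 * Y + 16 * Y) / (u ^ 4 * v ^ 2 * ε ^ 2) := div_add_one_le_div (by positivity) h1
      _ = _ := by ring
  have hHle' : (H : ℝ) ≤ 12 * Y / u := by
    have h1 : Real.log (3 * m.γ ^ h / (ε * u * v / 4 * u)) ≤ 11 * Y := by
      have h2 : Real.log (3 * m.γ ^ h / (ε * u * v / 4 * u)) ≤ Real.log (12 / (ε * u * v * u)) := by
        refine Real.log_le_log (by positivity) ?_
        rw [show 3 * m.γ ^ h / (ε * u * v / 4 * u) = 12 * m.γ ^ h / (ε * u * v * u) by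
          field_simp
          ring]
        gcongr
        linarith
      have h3 : Real.log (12 / (ε * u * v * u)) =
          Real.log 12 - (Real.log ε + Real.log u + Real.log v + Real.log u) := by
        rw [Real.log_div (by positivity) (by positivity),
          Real.log_mul (by positivity) (by positivity),
          Real.log_mul (by positivity) (by positivity),
          Real.log_mul (by positivity) (by positivity)]
      linarith
    have h3 : max (1 / u * Real.log (3 * m.γ ^ h / (ε * u * v / 4 * u))) 0 ≤ 1 / u * (11 * Y) :=
      max_le (by gcongr) (by positivity)
    calc (H : ℝ) ≤ 11 * Y / u + 1 := hHle.trans (by linarith [mul_comm_div 1 u (11 * Y)])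
      _ ≤ (11 * Y + Y) / u := div_add_one_le_div hu (hu1.trans hY1)
      _ = _ := by ring
  -- 104832 = 6 · 1456 · 12, and each of the three factors brings one power of Y.
  have h1 : (K : ℝ) * M₀ * H * s ≤ 104832 * (s / (h * ε ^ 2 * u ^ 6 * v ^ 2)) * Y ^ 3 := by
    calc (K : ℝ) * M₀ * H * s ≤
          6 * Y / (h * u) * (1456 * Y / (u ^ 4 * v ^ 2 * ε ^ 2)) * (12 * Y / u) * s := by gcongr
      _ = _ := by field_simp; ring
  have h2 : (K : ℝ) * h * M * s * a ≤ 104832 * (s * a / (ε ^ 2 * u ^ 7)) * Y ^ 3 := by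
    calc (K : ℝ) * h * M * s * a ≤
          6 * Y / (h * u) * h * (1456 * Y / (u ^ 6 * ε ^ 2)) * s * a := by gcongr
      _ = 8736 * (s * a / (ε ^ 2 * u ^ 7)) * Y ^ 2 := by field_simp; ring
      _ ≤ 104832 * (s * a / (ε ^ 2 * u ^ 7)) * Y ^ 3 := by
        gcongr
        · norm_num
        · norm_num
  linarith

end Complexity

end HPMD

theorem theorem3 :
    ∃ (C : ℝ) (p : ℕ), 0 < C ∧
      ∀ (S : Type u) (A : Type v) [Fintype S] [Fintype A] [Nonempty S] [Nonempty A]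
        (m : HPMD.MDP S A) (h : ℕ) (hh : 0 < h) (ε δ : ℝ), 0 < ε → 0 < δ → δ < 1 →
      ∀ K M M₀ H : ℕ,
        -- every run of the algorithm, on any probability space
        (∀ (φ : (A → ℝ) → ℝ) (dom : Set (A → ℝ)), HPMD.IsMirrorMap φ dom →
          ∀ π₀ : S → A → ℝ, HPMD.IsPolicy π₀ → (∀ s a, 0 < π₀ s a) →
          ∀ (Ω : Type w) (mΩ : MeasurableSpace Ω) (μ : Measure Ω) [IsProbabilityMeasure μ]
            (ℱ : Filtration ℕ mΩ) (X : Fin K → Ω → HPMD.Samples S A h M M₀ H)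
            (η : Fin K → Ω → ℝ) (π : ℕ → Ω → S → A → ℝ),
            HPMD.IsRun m φ hh π₀ μ ℱ X η π →
            -- each iteration, with confidence `1 - δ`
            (HPMD.Admissible m h ε δ K M M₀ H →
              ∀ k ≤ K, ENNReal.ofReal (1 - δ) ≤
                μ {ω | ‖m.Vstar - m.V (π k ω)‖ ≤ m.subopt h ε π₀ k}) ∧
            -- all iterations simultaneously, and the last iterate
            (HPMD.Admissible m h ε (δ / K) K M M₀ H →
              ENNReal.ofReal (1 - δ) ≤
                μ {ω | (∀ k ≤ K, ‖m.Vstar - m.V (π k ω)‖ ≤ m.subopt h ε π₀ k) ∧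
                  ‖m.Vstar - m.V (π K ω)‖ ≤ ε})) ∧
        -- the number of samples
        HPMD.totalSamples S A K h M M₀ H =
          K * M₀ * H * Fintype.card S + K * h * M * Fintype.card S * Fintype.card A ∧
        -- the sample complexity
        (1 ≤ m.iterBound h ε →
          (HPMD.LeastAdmissible m h ε δ K M M₀ H ∨
            HPMD.LeastAdmissible m h ε (δ / K) K M M₀ H) →
          (HPMD.totalSamples S A K h M M₀ H : ℝ) ≤
            C * (Fintype.card S / (h * ε ^ 2 * (1 - m.γ) ^ 6 * (1 - m.γ ^ h) ^ 2) +
                Fintype.card S * Fintype.card A / (ε ^ 2 * (1 - m.γ) ^ 7)) *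
              (1 + Real.log (Fintype.card S * Fintype.card A * h * (1 + 1 / ε) /
                (δ * (1 - m.γ)))) ^ p) := by
  refine ⟨104832, 3, by norm_num, ?_⟩
  intro S A _ _ _ _ m h hh ε δ hε hδ hδ1 K M M₀ H
  refine ⟨?_, HPMD.totalSamples_eq S A K h M M₀ H,
    fun hT hleast => m.totalSamples_le hh hε hδ hδ1 hT hleast⟩
  intro φ dom hφ π₀ hπ₀ hpos Ω mΩ μ _ ℱ X η π hrun
  exact ⟨fun hadm k hk => hrun.confidence_each hφ hπ₀ hpos hε hδ hδ1 hadm hk,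
    fun hadm => hrun.confidence_all hφ hπ₀ hpos hε hδ hδ1 hadm⟩
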